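/- **Notation.** Fix $q\in\mathbb C$ with $0<|q|<1$. For $0<|p|<1$ put $(x;q)=\prod_{r\ge0}(1-xq^r)$, $\theta(x;p)=(x;p)(p/x;p)$, $\theta(x;q;p)_n=\prod_{r=0}^{n-1}\theta(xq^r;p)$ and $\Gamma(x;p,q)=\prod_{i,j\ge0}\frac{1-p^{i+1}q^{j+1}/x}{1-p^iq^jx}$. Several arguments, or $\pm$ in an argument, denote a product; e.g. $(xz^{\pm1};q)=(xz;q)(x/z;q)$. We write $p=e^{L}$, $p^\tau=e^{\tau L}$ for $\tau\in\mathbb R$, and $p\to0$ means $\operatorname{Re}L\to-\infty$ (so all branches are allowed); functions "depending on $p$" may depend on $L$. *Function spaces.* Let $M$ be the set of series $f=\sum_{\tau\in T}a_\tau(z)p^\tau$ with $T\subset\mathbb R$ having finitely many elements below every bound and $a_\tau\in\mathbb C(z)\setminus\{0\}$ (with the zero series included), such that (i) $\deg a_\tau\le c\,(\tau-\mathrm{val} f)$ for some $c\in\mathbb R$ and all $\tau\in T$ with $\tau>\mathrm{val} f$, where $\mathrm{val} f=\min T$ and the degree of $z^na(z)/b(z)$, with $z,a,b$ coprime, is $\max(-n,n+\deg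 a-\deg b)$; and (ii) there is a polynomial $P\neq0$ such that the $a_\tau$ have no poles off the zero set of $P$, and for every compact $K$ disjoint from that zero set the series $p^{-\mathrm{val} f}f$ converges uniformly for $z\in K$ and all sufficiently small $p$. Put $lc(f)=a_{\mathrm{val} f}$ (with $lc(0)=0$ and $\mathrm{val}(0)=0$ by convention). For $u\in\mathbb C^*$ and $a\in\mathbb R$, $\tilde A(up^{a})$ is the set of families $f$ (in $p$) of functions of $z$ which are sums of a series in $M$ and for which there is an integer $m_f\geq 0$ such that, for all sufficiently small $p$, $f$ is meromorphic on $\mathbb C^*$, $f(z)=f(1/z)=f(pz)$, and $\theta(pqz^{\pm1}/(up^a);q;p)_{m_f}f(z)$ is holomorphic on $\mathbb C^*$. *Contours.* A contour is a cycle (an integer combination of closed piecewise $C^1$ curves) in $\mathbb C^*$ with winding number $1$ around $0$. It *includes* a point if it has winding number $1$ around it, and *excludes* a point if it has winding number $0$ around it (and does not pass through it). *Bilinear form.* For $t_0\cdots t_5=pq$, $f\in A(t_4;p,q)$, $g\in A(t_5;p,q)$ let $$\langle f,g\rangle_{t_0,\dots,t_5}=\frac{(q;q)(p;p)}{2\prod_{0\le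 r<s\le5}\Gamma(t_rt_s;p,q)}\int_C f(z)g(z)\frac{\prod_{r=0}^5\Gamma(t_rz^{\pm1};p,q)}{\Gamma(z^{\pm2};p,q)}\frac{dz}{2\pi iz},$$ where $A(u;p,q)$ is the space of symmetric $p$-abelian meromorphic functions on $\mathbb C^*$ that become holomorphic after multiplication by $\theta(pqz^{\pm1}/u;q;p)_m$ for some $m$. With $\tilde t_r=t_r$ ($r\le3$), $\tilde t_4=t_4q^{-m_f}$, $\tilde t_5=t_5q^{-m_g}$, the contour $C$ includes all points $p^iq^j\tilde t_r$ ($0\le r\le 5$, $i,j\ge0$) and excludes their reciprocals. **Proposition.** Let $t_0,\dots,t_5\in\mathbb C$ with $\prod_rt_r=q$, and let $\alpha\in\mathbb R^6$ with $\sum_{r=0}^5\alpha_r=1$ and $\alpha_r\ge0$ for all $r$. Let $f\in\tilde A(t_4p^{\alpha_4})$ and $g\in\tilde A(t_5p^{\alpha_5})$, with $m_f,m_g$ any admissible integers as above, and let $\tilde t_r$ be as above. Assume that the parameters are generic in the following sense: $\tilde t_r\tilde t_s\ne q^{-j}$ for all $j\ge0$ whenever $\alpha_r=\alpha_s=0$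 (including $r=s$), and $t_rt_s\ne q^{j+1}$ for all $j\ge0$ whenever $r\ne s$ and $\alpha_r+\alpha_s=1$. Then contours as described exist for $\langle f,g\rangle_{t_rp^{\alpha_r}}$ for all sufficiently small $p$, there is a contour $C$ which includes the points $q^j\tilde t_r$ ($j\ge0$, $0\le r\le5$ with $\alpha_r=0$) and excludes their reciprocals, and for every choice of these contours $$\lim_{p\to0}p^{-\mathrm{val}(f)-\mathrm{val}(g)}\langle f,g\rangle_{t_rp^{\alpha_r}}=\frac{(q;q)\prod_{r<s:\,\alpha_r+\alpha_s=0}(t_rt_s;q)}{2\prod_{r<s:\,\alpha_r+\alpha_s=1}(qt_r^{-1}t_s^{-1};q)}\int_C lc(f)(z)\,lc(g)(z)\,\frac{(z^{\pm2};q)\prod_{r:\alpha_r=1}(qt_r^{-1}z^{\pm1};q)}{\prod_{r:\alpha_r=0}(t_rz^{\pm1};q)}\frac{dz}{2\pi iz}.$$ The contour $C$ can be taken to be the positively oriented unit circle if $|\tilde t_r|<1$ for all $r$ with $\alpha_r=0$. -/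

import Mathlib

open Filter Topology Set Finset
open scoped Polynomial

noncomputable section

namespace EllipticLimit

/-! ### `q`-symbols -/

/-- `(x;q) = ∏_{r ≥ 0} (1 - x q^r)`. -/
def qPoch (x q : ℂ) : ℂ := ∏' r : ℕ, (1 - x * q ^ r)

/-- `(x;p,q) = ∏_{r,s ≥ 0} (1 - x p^r q^s)`. -/
def pqPoch (x p q : ℂ) : ℂ := ∏' n : ℕ × ℕ, (1 - x * p ^ n.1 * q ^ n.2)

/-- `θ(x;p) = (x, p/x; p)`. -/
def theta (x p : ℂ) : ℂ := qPoch x p * qPoch (p / x) p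

/-- `θ(x;q;p)_n = ∏_{r < n} θ(x q^r; p)`. -/
def thetaPoch (x q p : ℂ) (n : ℕ) : ℂ := ∏ r ∈ range n, theta (x * q ^ r) p

/-- The elliptic gamma function
`Γ(x;p,q) = ∏_{i,j ≥ 0} (1 - p^{i+1} q^{j+1} / x) / (1 - p^i q^j x)`. -/
def ellGamma (x p q : ℂ) : ℂ := pqPoch (p * q / x) p q / pqPoch x p q

/-! ### Contours: `1`-cycles in the plane -/

/-- A closed `C¹` curve in `ℂ`, parametrised by `[0,1]`. The derivative may vanish, so every
closed piecewise `C¹` curve is of this form after a reparametrisation. -/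
structure Loop where
  toFun : ℝ → ℂ
  contDiffOn : ContDiffOn ℝ 1 toFun (Set.Icc 0 1)
  closed : toFun 0 = toFun 1

/-- Integer linear combinations of closed curves. -/
abbrev Cycle : Type := Loop →₀ ℤ

/-- The set of points on the curves of a cycle. -/
def Cycle.trace (C : Cycle) : Set ℂ := ⋃ γ ∈ C.support, γ.toFun '' Set.Icc 0 1

/-- `∫_γ F(z) dz`. -/
def Loop.integral (γ : Loop) (F : ℂ → ℂ) : ℂ :=
  ∫ s in (0 : ℝ)..1, F (γ.toFun s) * derivWithin γ.toFun (Set.Icc 0 1) s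

/-- `∫_C F(z) dz`. -/
def Cycle.integral (C : Cycle) (F : ℂ → ℂ) : ℂ := C.sum fun γ n => (n : ℂ) * γ.integral F

/-- The winding number of a cycle around a point not on it. -/
def Cycle.winding (C : Cycle) (w : ℂ) : ℂ :=
  C.integral fun z => 1 / (2 * Real.pi * Complex.I * (z - w))

/-- `C` is a contour in `ℂ^*` going once around the origin, containing the points of `W` and
excluding their reciprocals. This determines the homology class of `C` in the complement of
`0`, `W` and `W⁻¹`, and this class is invariant under `z ↦ 1/z` (with orientation reversed). -/
structure IsContour (W : Set ℂ) (C : Cycle) : Prop where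
  zero_notMem : (0 : ℂ) ∉ C.trace
  winding_zero : C.winding 0 = 1
  notMem : ∀ w ∈ W, w ∉ C.trace
  winding_eq_one : ∀ w ∈ W, C.winding w = 1
  inv_notMem : ∀ w ∈ W, w⁻¹ ∉ C.trace
  winding_inv_eq_zero : ∀ w ∈ W, C.winding w⁻¹ = 0

/-- The positively oriented unit circle. -/
def unitLoop : Loop where
  toFun s := Complex.exp (2 * Real.pi * Complex.I * s)
  contDiffOn := by
    refine ContDiff.contDiffOn ?_
    exact (contDiff_const.mul Complex.ofRealCLM.contDiff).cexp
  closed := by simp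

def unitCircle : Cycle := Finsupp.single unitLoop 1

/-! ### The space `A(u₀;p,q)` -/

/-- The factor `θ(pq z^{±1}/u₀;q;p)_m`. -/
def poleFactor (u₀ p q : ℂ) (m : ℕ) (z : ℂ) : ℂ :=
  thetaPoch (p * q * z / u₀) q p m * thetaPoch (p * q * z⁻¹ / u₀) q p m

/-- `f ∈ A(u₀;p,q)` with `m_f = m`: the function `f` on `ℂ^*` is symmetric and `p`-abelian, and
`θ(pq z^{±1}/u₀;q;p)_m f(z)` is holomorphic on `ℂ^*`. The values of `f` at the possible poles,
that is, at the zeros of the factor (a set stable under `z ↦ 1/z` and `z ↦ pz`), are left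
unspecified. -/
structure MemA (u₀ p q : ℂ) (m : ℕ) (f : ℂ → ℂ) : Prop where
  symm : ∀ z : ℂ, z ≠ 0 → poleFactor u₀ p q m z ≠ 0 → f z⁻¹ = f z
  abelian : ∀ z : ℂ, z ≠ 0 → poleFactor u₀ p q m z ≠ 0 → f (p * z) = f z
  holomorphic : ∃ h : ℂ → ℂ, DifferentiableOn ℂ h {0}ᶜ ∧
    ∀ z : ℂ, z ≠ 0 → poleFactor u₀ p q m z ≠ 0 → poleFactor u₀ p q m z * f z = h z

/-! ### Power series in `p` with real exponents

A series `∑ a_τ(z) p^τ` is a Hahn series with real exponents and coefficients in `ℂ(z)`; its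
valuation is `HahnSeries.order` and its leading coefficient is `HahnSeries.leadingCoeff`.
To make sense of `p^τ` for nonreal `p` and all branches at once, put `p = exp L` and
`p^τ = exp (τ L)`; then `p → 0` means `re L → -∞`. -/

/-- `p^τ`, where `p = exp L`. -/
def pPow (L : ℂ) (τ : ℝ) : ℂ := Complex.exp (τ * L)

/-- `p → 0`, where `p = exp L`. -/
def pToZero : Filter ℂ := comap Complex.re atBot

/-- The value of a rational function at `z` (meaningful away from its poles). -/
def evalAt (z : ℂ) (r : RatFunc ℂ) : ℂ := RatFunc.eval (RingHom.id ℂ) z r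

/-- The degree `max (-n, n + deg a - deg b)` of `z^n a(z)/b(z)`, with `z`, `a`, `b` coprime. -/
def ratDegree (r : RatFunc ℂ) : ℤ :=
  max ((r.denom.rootMultiplicity 0 : ℤ) - r.num.rootMultiplicity 0) r.intDegree

/-- Membership in `F(z)`: the set of exponents is discrete and bounded from below. -/
def MemF (S : HahnSeries ℝ (RatFunc ℂ)) : Prop :=
  ∀ B : ℝ, (S.support ∩ Set.Iic B).Finite

/-- Membership in `R(z)`: the degrees of the coefficients grow at most linearly. -/
def MemR (S : HahnSeries ℝ (RatFunc ℂ)) : Prop :=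
  MemF S ∧ ∃ c : ℝ, ∀ τ ∈ S.support, S.order < τ →
    (ratDegree (S.coeff τ) : ℝ) ≤ c * (τ - S.order)

/-- The partial sum over the exponents `τ ≤ B` of `p^{-val S} S = ∑ a_τ(z) p^{τ - val S}`. -/
def partialSum (S : HahnSeries ℝ (RatFunc ℂ)) (B : ℝ) (L z : ℂ) : ℂ :=
  ∑ᶠ τ ∈ S.support ∩ Set.Iic B, evalAt z (S.coeff τ) * pPow L (τ - S.order)

/-- The family `f` of functions of `z` (depending on `p = exp L`) is the sum of the series
`S ∈ M(z)`: away from the zero set of some polynomial the coefficients have no poles, and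
`p^{-val S} S` converges to `p^{-val S} f` uniformly for `z` in compacta and `p` near `0`. -/
def IsSumInM (S : HahnSeries ℝ (RatFunc ℂ)) (f : ℂ → ℂ → ℂ) : Prop :=
  MemR S ∧ ∃ P : ℂ[X], P ≠ 0 ∧
    (∀ τ ∈ S.support, ∀ z : ℂ, P.eval z ≠ 0 → (S.coeff τ).denom.eval z ≠ 0) ∧
    ∀ K : Set ℂ, IsCompact K → K ⊆ {z | P.eval z ≠ 0} →
      ∃ ρ : ℝ, TendstoUniformlyOn (fun (B : ℝ) (x : ℂ × ℂ) => partialSum S B x.1 x.2)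
        (fun x => pPow x.1 (-S.order) * f x.1 x.2) atTop ({L : ℂ | L.re ≤ ρ} ×ˢ K)

/-- The family `f` belongs to `Ã(t p^a; p, q) = A(t p^a; p, q) ∩ M`, with `m_f = m` and with
expansion `S` in powers of `p`. -/
structure MemTildeA (q t : ℂ) (a : ℝ) (m : ℕ) (S : HahnSeries ℝ (RatFunc ℂ))
    (f : ℂ → ℂ → ℂ) : Prop where
  memA : ∀ᶠ L in pToZero, MemA (t * pPow L a) (Complex.exp L) q m (f L)
  isSumInM : IsSumInM S f

/-! ### The bilinear forms -/

/-- `t̃_r = t_r` for `r ≤ 3`, `t̃₄ = t₄ q^{-m_f}`, `t̃₅ = t₅ q^{-m_g}`. -/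
def tilde (q : ℂ) (mf mg : ℕ) (t : Fin 6 → ℂ) (r : Fin 6) : ℂ :=
  t r / q ^ (![0, 0, 0, 0, mf, mg] r)

/-- The points `p^i q^j t̃_r` that a contour of the elliptic bilinear form has to contain. -/
def ellipticPoints (p q : ℂ) (tt : Fin 6 → ℂ) : Set ℂ :=
  {w | ∃ (r : Fin 6) (i j : ℕ), w = p ^ i * q ^ j * tt r}

/-- The elliptic bilinear form `⟨f,g⟩_{t₀,…,t₅;q;p}`, computed along the contour `C`. -/
def bilinearForm (p q : ℂ) (t : Fin 6 → ℂ) (C : Cycle) (f g : ℂ → ℂ) : ℂ :=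
  qPoch q q * qPoch p p / (2 * ∏ r : Fin 6, ∏ s ∈ Finset.Ioi r, ellGamma (t r * t s) p q) *
    C.integral fun z =>
      f z * g z *
        ((∏ r : Fin 6, (ellGamma (t r * z) p q * ellGamma (t r * z⁻¹) p q)) /
          (ellGamma (z ^ 2) p q * ellGamma (z⁻¹ ^ 2) p q)) *
        (1 / (2 * Real.pi * Complex.I * z))

/-- The points `q^j t̃_r` with `α_r = 0`, which a contour of the limit form has to contain. -/
def limitPoints (q : ℂ) (α : Fin 6 → ℝ) (tt : Fin 6 → ℂ) : Set ℂ :=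
  {w | ∃ (r : Fin 6) (j : ℕ), α r = 0 ∧ w = q ^ j * tt r}

/-- The limiting (Nasrallah-Rahman type) bilinear form, computed along the contour `C`. -/
def limitForm (q : ℂ) (t : Fin 6 → ℂ) (α : Fin 6 → ℝ) (C : Cycle) (F G : ℂ → ℂ) : ℂ :=
  (qPoch q q * ∏ r : Fin 6, ∏ s ∈ Finset.Ioi r with α r + α s = 0, qPoch (t r * t s) q) /
      (2 * ∏ r : Fin 6, ∏ s ∈ Finset.Ioi r with α r + α s = 1,
        qPoch (q * (t r)⁻¹ * (t s)⁻¹) q) *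
    C.integral fun z =>
      F z * G z *
        ((qPoch (z ^ 2) q * qPoch (z⁻¹ ^ 2) q *
            ∏ r : Fin 6 with α r = 1,
              (qPoch (q * (t r)⁻¹ * z) q * qPoch (q * (t r)⁻¹ * z⁻¹) q)) /
          ∏ r : Fin 6 with α r = 0, (qPoch (t r * z) q * qPoch (t r * z⁻¹) q)) *
        (1 / (2 * Real.pi * Complex.I * z))

end EllipticLimit

end

open EllipticLimit

namespace EllipticLimit

/-! ### Infinite products -/

/-! Put p = exp L. The elliptic form is moved to one contour that does not depend on p, and the
limit is then taken under the integral sign.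

Moving the contour. By Γ(qx) = θ(x;p)Γ(x), the theta product that clears the poles of f turns Γ(u
q^{-m} z^{±1}) into Γ(u z^{±1}) (`poleFactor_mul_ellGamma`). Hence f Γ(t₄p^{α₄}z^{±1}) = h_f
Γ(t̃₄p^{α₄}z^{±1}) with h_f holomorphic on ℂ^*, and likewise for g. Off a countable set the
integrand is h_f h_g times `weight` with the parameters t̃_r p^{α_r}, which is singular at most at
0, at the points the contour includes, and at their reciprocals. Cauchy's theorem for cycles, in
Dixon's version, shows that all admissible contours give the same integral (`integral_elliptic_eq`).
As p → 0, the points to be included are either q^j t̃_r with α_r = 0 or uniformly close to 0, with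
reciprocals close to infinity. So a contour C of the limit form is admissible for all small p
(`IsContour.eventually_ellipticPoints`).

Taking the limit. For 0 ≤ σ ≤ 1, Γ(t p^σ y;p,q) has an explicit limit, nontrivial only for σ = 0 and
σ = 1 (`tendsto_ellGamma`). Since the α_r are nonnegative with sum 1, this applies to σ = α_r in the
weight and to σ = α_r + α_s in the prefactor. The functions p^{-val f} f converge to lc(f) locally
uniformly off a finite set only, and C may pass through that set. Two facts deal with this. The
maximum principle carries a bound for p^{-val f} h_f from a circle avoiding the bad points to its
interior (`MemTildeA.exists_holomorphic`). A C¹ curve meets a countable set, up to a null set of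
times, only where its derivative vanishes, so convergence off a countable set is enough for
dominated convergence (`Cycle.tendsto_integral`). -/

theorem summable_geometric_prod {r s : ℝ} (hr₀ : 0 ≤ r) (hr : r < 1) (hs₀ : 0 ≤ s) (hs : s < 1)
    (c : ℝ) : Summable fun n : ℕ × ℕ => c * r ^ n.1 * s ^ n.2 := by
  have h := (summable_geometric_of_lt_one hr₀ hr).mul_of_nonneg
    (summable_geometric_of_lt_one hs₀ hs) (fun n => by positivity) (fun n => by positivity)
  simpa [mul_assoc] using h.mul_left c

theorem norm_pqTerm (x p q : ℂ) (n : ℕ × ℕ) :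
    ‖-(x * p ^ n.1 * q ^ n.2)‖ = ‖x‖ * ‖p‖ ^ n.1 * ‖q‖ ^ n.2 := by
  simp

theorem pqPoch_eq (x p q : ℂ) : pqPoch x p q = ∏' n : ℕ × ℕ, (1 + -(x * p ^ n.1 * q ^ n.2)) := by
  simp only [pqPoch, sub_eq_add_neg]

theorem summable_norm_pqTerm (x : ℂ) {p q : ℂ} (hp : ‖p‖ < 1) (hq : ‖q‖ < 1) :
    Summable fun n : ℕ × ℕ => ‖-(x * p ^ n.1 * q ^ n.2)‖ := by
  simp only [norm_pqTerm]
  exact summable_geometric_prod (norm_nonneg _) hp (norm_nonneg _) hq _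

theorem multipliable_pq (x : ℂ) {p q : ℂ} (hp : ‖p‖ < 1) (hq : ‖q‖ < 1) :
    Multipliable fun n : ℕ × ℕ => (1 - x * p ^ n.1 * q ^ n.2) := by
  simpa only [sub_eq_add_neg] using multipliable_one_add_of_summable (summable_norm_pqTerm x hp hq)

theorem multipliable_q (x : ℂ) {q : ℂ} (hq : ‖q‖ < 1) :
    Multipliable fun n : ℕ => (1 - x * q ^ n) := by
  have : Summable fun n : ℕ => ‖-(x * q ^ n)‖ := by
    simpa using (summable_geometric_of_lt_one (norm_nonneg q) hq).mul_left ‖x‖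
  simpa only [sub_eq_add_neg] using multipliable_one_add_of_summable this

/-- Dominated convergence for products: with ‖p₀‖ < r < 1, the terms are eventually dominated by
(‖x₀‖ + 1) r^i ‖q‖^j. The value p₀ = 0 is allowed, and this is the case behind all limits p → 0. -/
theorem tendsto_pqPoch {ι : Type*} {l : Filter ι} {x p : ι → ℂ} {x₀ p₀ q : ℂ}
    (hx : Tendsto x l (𝓝 x₀)) (hp : Tendsto p l (𝓝 p₀)) (hp₀ : ‖p₀‖ < 1) (hq : ‖q‖ < 1) :
    Tendsto (fun a => pqPoch (x a) (p a) q) l (𝓝 (pqPoch x₀ p₀ q)) := by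
  obtain ⟨r, hr₀, hr₁⟩ := exists_between hp₀
  simp only [pqPoch_eq]
  refine tendsto_tprod_one_add_of_dominated_convergence
    (bound := fun n : ℕ × ℕ => (‖x₀‖ + 1) * r ^ n.1 * ‖q‖ ^ n.2)
    (summable_geometric_prod ((norm_nonneg _).trans hr₀.le) hr₁ (norm_nonneg _) hq _)
    (fun n => ((hx.mul (hp.pow _)).mul_const _).neg) ?_
  filter_upwards [hx.norm.eventually (gt_mem_nhds (lt_add_one _)),
    hp.norm.eventually (gt_mem_nhds hr₀)] with a h₁ h₂ n
  rw [norm_pqTerm]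
  gcongr

theorem pqPoch_eq_zero {x p q : ℂ} (hp : ‖p‖ < 1) (hq : ‖q‖ < 1) (h : pqPoch x p q = 0) :
    ∃ i j : ℕ, x * p ^ i * q ^ j = 1 := by
  by_contra! hne
  rw [pqPoch_eq] at h
  exact tprod_one_add_ne_zero_of_summable
    (fun n e => hne n.1 n.2 (by linear_combination -e)) (summable_norm_pqTerm x hp hq) h

theorem pqPoch_ne_zero {x p q : ℂ} (hp : ‖p‖ < 1) (hq : ‖q‖ < 1)
    (h : ∀ i j : ℕ, x * p ^ i * q ^ j ≠ 1) : pqPoch x p q ≠ 0 := fun e => by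
  obtain ⟨i, j, hij⟩ := pqPoch_eq_zero hp hq e
  exact h i j hij

theorem differentiable_pqPoch {p q : ℂ} (hp : ‖p‖ < 1) (hq : ‖q‖ < 1) :
    Differentiable ℂ fun x => pqPoch x p q := by
  intro x₀
  have h := Summable.hasProdLocallyUniformlyOn_one_add (f := fun (n : ℕ × ℕ) (x : ℂ) =>
      -(x * p ^ n.1 * q ^ n.2)) (Metric.isOpen_ball (x := (0 : ℂ)) (ε := ‖x₀‖ + 1))
    (summable_geometric_prod (norm_nonneg p) hp (norm_nonneg q) hq (‖x₀‖ + 1))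
    (Eventually.of_forall fun n x hx => by
      rw [norm_pqTerm]
      have : ‖x‖ ≤ ‖x₀‖ + 1 := by simpa using (mem_ball_zero_iff.1 hx).le
      gcongr) (fun n => by fun_prop)
  have hd : DifferentiableOn ℂ (fun x => pqPoch x p q) (Metric.ball 0 (‖x₀‖ + 1)) := by
    simp only [pqPoch_eq]
    refine TendstoLocallyUniformlyOn.differentiableOn h (Eventually.of_forall fun s => ?_)
      Metric.isOpen_ball
    simp only
    fun_prop
  exact hd.differentiableAt (Metric.isOpen_ball.mem_nhds (by simp))

/-- Since 0^0 = 1, base 0 leaves only the factors with second index 0. Convergence and holomorphy of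
single products thus become special cases of those of double products. -/
theorem qPoch_eq_pqPoch_zero (x p : ℂ) : qPoch x p = pqPoch x p 0 := by
  have hinj : Function.Injective fun i : ℕ => (i, 0) := fun i j h => (Prod.ext_iff.1 h).1
  rw [qPoch, pqPoch, ← hinj.tprod_eq]
  · simp
  · intro n hn
    rcases n with ⟨i, j⟩
    rcases j with _ | j
    · exact ⟨i, rfl⟩
    · simp at hn

theorem pqPoch_zero (x q : ℂ) : pqPoch x 0 q = qPoch x q := by
  have hinj : Function.Injective fun j : ℕ => (0, j) := fun i j h => (Prod.ext_iff.1 h).2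
  rw [qPoch, pqPoch, ← hinj.tprod_eq]
  · simp
  · intro n hn
    rcases n with ⟨i, j⟩
    rcases i with _ | i
    · exact ⟨j, rfl⟩
    · simp at hn

theorem pqPoch_comm (x p q : ℂ) : pqPoch x p q = pqPoch x q p := by
  rw [pqPoch, pqPoch, ← (Equiv.prodComm ℕ ℕ).tprod_eq]
  exact tprod_congr fun n => by simp; ring

theorem pqPoch_eq_mul_left (x : ℂ) {p q : ℂ} (hp : ‖p‖ < 1) (hq : ‖q‖ < 1) :
    pqPoch x p q = qPoch x q * pqPoch (p * x) p q := by
  have key : ∀ x : ℂ, pqPoch x p q = ∏' i : ℕ, qPoch (x * p ^ i) q ∧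
      Multipliable fun i : ℕ => qPoch (x * p ^ i) q := fun x => by
    have hf : ∀ i : ℕ, Multipliable fun j : ℕ => (1 - x * p ^ i * q ^ j) :=
      fun i => multipliable_q _ hq
    exact ⟨(multipliable_pq x hp hq).tprod_prod' hf,
      ((multipliable_pq x hp hq).hasProd.prod_fiberwise fun i => (hf i).hasProd).multipliable⟩
  have e : ∀ i : ℕ, qPoch (x * p ^ (i + 1)) q = qPoch (p * x * p ^ i) q := fun i => by
    rw [pow_succ]; congr 1; ring
  rw [(key x).1, tprod_eq_zero_mul', (key (p * x)).1]
  · simp [e]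
  · simpa only [e] using (key (p * x)).2

theorem pqPoch_eq_mul_right (x : ℂ) {p q : ℂ} (hp : ‖p‖ < 1) (hq : ‖q‖ < 1) :
    pqPoch x p q = qPoch x p * pqPoch (q * x) p q := by
  rw [pqPoch_comm, pqPoch_eq_mul_left x hq hp, pqPoch_comm]

theorem tendsto_qPoch {ι : Type*} {l : Filter ι} {x p : ι → ℂ} {x₀ p₀ : ℂ}
    (hx : Tendsto x l (𝓝 x₀)) (hp : Tendsto p l (𝓝 p₀)) (hp₀ : ‖p₀‖ < 1) :
    Tendsto (fun a => qPoch (x a) (p a)) l (𝓝 (qPoch x₀ p₀)) := by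
  simpa only [qPoch_eq_pqPoch_zero] using tendsto_pqPoch hx hp hp₀ (q := 0) (by simp)

theorem differentiable_qPoch {p : ℂ} (hp : ‖p‖ < 1) : Differentiable ℂ fun x => qPoch x p := by
  simpa only [qPoch_eq_pqPoch_zero] using differentiable_pqPoch hp (q := 0) (by simp)

theorem qPoch_ne_zero {x q : ℂ} (hq : ‖q‖ < 1) (h : ∀ j : ℕ, x * q ^ j ≠ 1) : qPoch x q ≠ 0 := by
  rw [← pqPoch_zero]
  refine pqPoch_ne_zero (by simp) hq fun i j => ?_
  rcases i with _ | i
  · simpa using h j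
  · simp

theorem qPoch_eq_zero {x q : ℂ} (hq : ‖q‖ < 1) (h : qPoch x q = 0) : ∃ j : ℕ, x * q ^ j = 1 := by
  by_contra! hne
  exact qPoch_ne_zero hq hne h

@[simp] theorem qPoch_zero_left (q : ℂ) : qPoch 0 q = 1 := by simp [qPoch]

@[simp] theorem qPoch_zero_right (x : ℂ) : qPoch x 0 = 1 - x := by
  rw [qPoch, tprod_eq_mulSingle 0]
  · simp
  · intro j hj
    simp [hj]

/-! ### Theta functions and elliptic gamma functions -/

theorem theta_div {x p : ℂ} (hp : p ≠ 0) : theta (p / x) p = theta x p := by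
  rw [theta, theta, div_div_cancel₀ hp, mul_comm]

/-- Apply θ(p/x;p) = θ(x;p) to each factor and reverse the order of the product, so that q^{-(r+1)}
becomes q^{-m} q^{m-1-r}. -/
theorem thetaPoch_reflect {u p q z : ℂ} (hp : p ≠ 0) (hq : q ≠ 0) (hz : z ≠ 0) (hu : u ≠ 0)
    (m : ℕ) : thetaPoch (p * q * z / u) q p m = thetaPoch (u / q ^ m * z⁻¹) q p m := by
  rw [thetaPoch, thetaPoch, ← Finset.prod_range_reflect]
  refine Finset.prod_congr rfl fun r hr => ?_
  have hr' : r < m := Finset.mem_range.1 hr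
  rw [← theta_div hp]
  congr 1
  have : m = (m - 1 - r) + r + 1 := by omega
  have e : q ^ m = q ^ (m - 1 - r) * q ^ r * q := by
    conv_lhs => rw [this]
    ring
  rw [e]
  field_simp

theorem poleFactor_eq {u p q z : ℂ} (hp : p ≠ 0) (hq : q ≠ 0) (hz : z ≠ 0) (hu : u ≠ 0) (m : ℕ) :
    poleFactor u p q m z = thetaPoch (u / q ^ m * z) q p m * thetaPoch (u / q ^ m * z⁻¹) q p m := by
  rw [poleFactor, thetaPoch_reflect hp hq hz hu, thetaPoch_reflect hp hq (inv_ne_zero hz) hu,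
    inv_inv, mul_comm]

/-- The functional equation Γ(qx) = θ(x;p)Γ(x). At a zero of (x;p) the quotient defining Γ(x) is a
division by zero with value 0, hence the condition on θ. -/
theorem theta_mul_ellGamma {x p q : ℂ} (hp : ‖p‖ < 1) (hq : ‖q‖ < 1) (hq₀ : q ≠ 0)
    (h : theta x p ≠ 0) : theta x p * ellGamma x p q = ellGamma (q * x) p q := by
  have h₁ : qPoch x p ≠ 0 := left_ne_zero_of_mul h
  rw [ellGamma, ellGamma, pqPoch_eq_mul_right x hp hq, theta,
    show p * q / (q * x) = p / x by rw [mul_comm p, mul_div_mul_left _ _ hq₀],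
    pqPoch_eq_mul_right (p / x) hp hq, show q * (p / x) = p * q / x by ring]
  field_simp

theorem thetaPoch_mul_ellGamma {x p q : ℂ} (hp : ‖p‖ < 1) (hq : ‖q‖ < 1) (hq₀ : q ≠ 0) :
    ∀ {m : ℕ}, thetaPoch x q p m ≠ 0 →
      thetaPoch x q p m * ellGamma x p q = ellGamma (q ^ m * x) p q
  | 0, _ => by simp [thetaPoch]
  | m + 1, h => by
    rw [thetaPoch, Finset.prod_range_succ] at h ⊢
    have ih := thetaPoch_mul_ellGamma hp hq hq₀ (x := x) (m := m) (left_ne_zero_of_mul h)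
    rw [thetaPoch] at ih
    rw [mul_right_comm, ih, mul_comm (ellGamma _ _ _), mul_comm x,
      theta_mul_ellGamma hp hq hq₀ (by simpa [mul_comm] using right_ne_zero_of_mul h)]
    congr 1
    ring

theorem poleFactor_mul_ellGamma {u p q z : ℂ} (hp : ‖p‖ < 1) (hp₀ : p ≠ 0) (hq : ‖q‖ < 1)
    (hq₀ : q ≠ 0) (hz : z ≠ 0) (hu : u ≠ 0) {m : ℕ} (h : poleFactor u p q m z ≠ 0) :
    ellGamma (u * z) p q * ellGamma (u * z⁻¹) p q = poleFactor u p q m z *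
      (ellGamma (u / q ^ m * z) p q * ellGamma (u / q ^ m * z⁻¹) p q) := by
  rw [poleFactor_eq hp₀ hq₀ hz hu] at h ⊢
  rw [mul_mul_mul_comm, thetaPoch_mul_ellGamma hp hq hq₀ (left_ne_zero_of_mul h),
    thetaPoch_mul_ellGamma hp hq hq₀ (right_ne_zero_of_mul h)]
  have : q ^ m ≠ 0 := pow_ne_zero _ hq₀
  congr 2 <;> field_simp

/-- `1/Γ(x^{±1};p,q)` away from the zeros of the numerators of the gamma functions. -/
theorem inv_ellGamma_mul_inv_ellGamma {x p q : ℂ} (hp : ‖p‖ < 1) (hq : ‖q‖ < 1)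
    (h₁ : pqPoch (p * q * x) p q ≠ 0) (h₂ : pqPoch (p * q * x⁻¹) p q ≠ 0) :
    (ellGamma x p q * ellGamma x⁻¹ p q)⁻¹ =
      qPoch x q * qPoch (p * x) p * (qPoch x⁻¹ q * qPoch (p * x⁻¹) p) := by
  have e : ∀ y : ℂ, pqPoch y p q = qPoch y q * (qPoch (p * y) p * pqPoch (p * q * y) p q) :=
    fun y => by rw [pqPoch_eq_mul_left y hp hq, pqPoch_eq_mul_right (p * y) hp hq]; ring_nf
  rw [ellGamma, ellGamma, div_inv_eq_mul, div_eq_mul_inv (p * q) x, e x, e x⁻¹]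
  generalize pqPoch (p * q * x) p q = a at *
  generalize pqPoch (p * q * x⁻¹) p q = b at *
  field_simp

/-! ### Integrals over loops and cycles -/

/-- The set of points on a loop. -/
abbrev Loop.image (γ : Loop) : Set ℂ := γ.toFun '' Set.Icc 0 1

theorem Loop.isCompact_image (γ : Loop) : IsCompact γ.image :=
  isCompact_Icc.image_of_continuousOn γ.contDiffOn.continuousOn

theorem Loop.continuousOn_derivWithin (γ : Loop) :
    ContinuousOn (derivWithin γ.toFun (Set.Icc 0 1)) (Set.Icc 0 1) :=
  γ.contDiffOn.continuousOn_derivWithin (uniqueDiffOn_Icc zero_lt_one) le_rfl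

theorem Loop.hasDerivAt (γ : Loop) {s : ℝ} (hs : s ∈ Set.Ioo (0 : ℝ) 1) :
    HasDerivAt γ.toFun (derivWithin γ.toFun (Set.Icc 0 1) s) s :=
  ((γ.contDiffOn.differentiableOn (by simp)) s
    (Set.Ioo_subset_Icc_self hs)).hasDerivWithinAt.hasDerivAt (Icc_mem_nhds hs.1 hs.2)

theorem Loop.continuousOn_integrand (γ : Loop) {F : ℂ → ℂ} (hF : ContinuousOn F γ.image) :
    ContinuousOn (fun s => F (γ.toFun s) * derivWithin γ.toFun (Set.Icc 0 1) s) (Set.Icc 0 1) :=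
  (hF.comp γ.contDiffOn.continuousOn (Set.mapsTo_image _ _)).mul γ.continuousOn_derivWithin

theorem Loop.intervalIntegrable (γ : Loop) {F : ℂ → ℂ} (hF : ContinuousOn F γ.image) :
    IntervalIntegrable (fun s => F (γ.toFun s) * derivWithin γ.toFun (Set.Icc 0 1) s)
      MeasureTheory.volume 0 1 :=
  ContinuousOn.intervalIntegrable (by
    rw [Set.uIcc_of_le zero_le_one]; exact γ.continuousOn_integrand hF)

theorem Loop.integral_eq_zero_of_hasDerivAt (γ : Loop) {F G : ℂ → ℂ}
    (hF : ContinuousOn F γ.image) (hG : ∀ z ∈ γ.image, HasDerivAt G (F z) z) :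
    γ.integral F = 0 := by
  rw [Loop.integral, intervalIntegral.integral_eq_sub_of_hasDerivAt_of_le (f := G ∘ γ.toFun)
    zero_le_one _ _ (γ.intervalIntegrable hF)]
  · simp [γ.closed]
  · exact ContinuousOn.comp (t := γ.image) (fun z hz => (hG z hz).continuousAt.continuousWithinAt)
      γ.contDiffOn.continuousOn (Set.mapsTo_image _ _)
  · intro s hs
    exact (hG _ (Set.mem_image_of_mem _ (Set.Ioo_subset_Icc_self hs))).comp s (γ.hasDerivAt hs)

/-- A time at which the curve is at `a` with nonzero velocity is isolated among such times, and a
discrete subset of ℝ is countable. -/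
theorem Loop.countable_setOf_eq (γ : Loop) (a : ℂ) :
    {s ∈ Set.Ioo (0 : ℝ) 1 | γ.toFun s = a ∧
      derivWithin γ.toFun (Set.Icc 0 1) s ≠ 0}.Countable := by
  set S := {s ∈ Set.Ioo (0 : ℝ) 1 | γ.toFun s = a ∧ derivWithin γ.toFun (Set.Icc 0 1) s ≠ 0}
  have : DiscreteTopology S := by
    rw [discreteTopology_subtype_iff]
    rintro s ⟨hs, -, hd⟩
    rw [← disjoint_iff, Filter.disjoint_principal_right]
    filter_upwards [(γ.hasDerivAt hs).eventually_ne (c := a) hd] with u hu hu'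
    exact hu hu'.2.1
  exact Set.countable_coe_iff.1 (countable_of_Lindelof_of_discrete)

/-- This makes countable exceptional sets negligible for line integrals, even if the curve rests at
an exceptional point: the factor γ' kills the integrand there. -/
theorem Loop.ae_derivWithin_eq_zero (γ : Loop) {N : Set ℂ} (hN : N.Countable) :
    ∀ᵐ s : ℝ, s ∈ Set.uIoc (0 : ℝ) 1 → γ.toFun s ∈ N →
      derivWithin γ.toFun (Set.Icc 0 1) s = 0 := by
  have h : ((⋃ a ∈ N, {s ∈ Set.Ioo (0 : ℝ) 1 | γ.toFun s = a ∧
      derivWithin γ.toFun (Set.Icc 0 1) s ≠ 0}) ∪ {1}).Countable :=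
    (hN.biUnion fun a _ => γ.countable_setOf_eq a).union (Set.countable_singleton 1)
  filter_upwards [h.ae_notMem MeasureTheory.volume] with s hs h₁ h₂
  rw [Set.uIoc_of_le zero_le_one] at h₁
  by_contra h₃
  rcases h₁.2.lt_or_eq with h₄ | h₄
  · exact hs (Or.inl (Set.mem_biUnion h₂ ⟨⟨h₁.1, h₄⟩, rfl, h₃⟩))
  · exact hs (Or.inr h₄)

theorem Loop.integral_congr (γ : Loop) {F G : ℂ → ℂ} {N : Set ℂ} (hN : N.Countable)
    (h : ∀ z ∈ γ.image, z ∉ N → F z = G z) : γ.integral F = γ.integral G := by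
  refine intervalIntegral.integral_congr_ae ?_
  filter_upwards [γ.ae_derivWithin_eq_zero hN] with s hs h₁
  by_cases h₂ : γ.toFun s ∈ N
  · simp [hs h₁ h₂]
  · rw [Set.uIoc_of_le zero_le_one] at h₁
    rw [h _ (Set.mem_image_of_mem _ (Set.Ioc_subset_Icc_self h₁)) h₂]

/-- Differentiation under the integral sign. Cauchy's estimate on discs of radius r/2 bounds the
derivative by M/(r/2) on the half-size ball, which gives the dominating function. -/
theorem Loop.differentiableAt_integral (γ : Loop) {G : ℂ → ℂ → ℂ} {z₀ : ℂ} {r M : ℝ} (hr : 0 < r)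
    (hd : ∀ w ∈ γ.image, DifferentiableOn ℂ (fun z => G z w) (Metric.ball z₀ r))
    (hb : ∀ w ∈ γ.image, ∀ z ∈ Metric.ball z₀ r, ‖G z w‖ ≤ M)
    (hc : ∀ z ∈ Metric.ball z₀ r, ContinuousOn (G z) γ.image) :
    DifferentiableAt ℂ (fun z => γ.integral (G z)) z₀ := by
  have hmem : ∀ {s : ℝ}, s ∈ Set.uIoc (0 : ℝ) 1 → γ.toFun s ∈ γ.image := fun {s} hs => by
    rw [Set.uIoc_of_le zero_le_one] at hs
    exact Set.mem_image_of_mem _ (Set.Ioc_subset_Icc_self hs)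
  have hball : Metric.ball z₀ r ∈ 𝓝 z₀ := Metric.ball_mem_nhds _ hr
  have hmeas : ∀ z ∈ Metric.ball z₀ r, MeasureTheory.AEStronglyMeasurable
      (fun s => G z (γ.toFun s) * derivWithin γ.toFun (Set.Icc 0 1) s)
      (MeasureTheory.volume.restrict (Set.uIoc 0 1)) := fun z hz =>
    (intervalIntegrable_iff.1 (γ.intervalIntegrable (hc z hz))).1
  have hderiv : ∀ w ∈ γ.image, ∀ z ∈ Metric.ball z₀ r,
      HasDerivAt (fun z => G z w) (deriv (fun z => G z w) z) z := fun w hw z hz =>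
    ((hd w hw).differentiableAt (Metric.isOpen_ball.mem_nhds hz)).hasDerivAt
  refine (intervalIntegral.hasDerivAt_integral_of_dominated_loc_of_deriv_le
    (s := Metric.ball z₀ (r / 2))
    (F := fun z s => G z (γ.toFun s) * derivWithin γ.toFun (Set.Icc 0 1) s)
    (F' := fun z s => deriv (fun z => G z (γ.toFun s)) z * derivWithin γ.toFun (Set.Icc 0 1) s)
    (bound := fun s => M / (r / 2) * ‖derivWithin γ.toFun (Set.Icc 0 1) s‖)
    (Metric.ball_mem_nhds _ (half_pos hr)) ?_ (γ.intervalIntegrable (hc z₀ (Metric.mem_ball_self hr)))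
    ?_ ?_ ?_ ?_).2.differentiableAt
  · filter_upwards [hball] with z hz using hmeas z hz
  -- Measurability of the z-derivative in s: it is the pointwise limit of difference quotients along
  -- `u n` → z₀. The shift n + 2 keeps `u n` inside the ball.
  · let u : ℕ → ℂ := fun n => z₀ + (r / (n + 2) : ℝ)
    have hu_ne : ∀ n, u n ≠ z₀ := fun n => by
      have : (r / (n + 2) : ℝ) ≠ 0 := by positivity
      simpa [u] using ⟨hr.ne', by exact_mod_cast (by positivity : (n + 2 : ℝ) ≠ 0)⟩
    have hu_mem : ∀ n, u n ∈ Metric.ball z₀ r := fun n => by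
      rw [mem_ball_iff_norm, show u n - z₀ = ((r / (n + 2) : ℝ) : ℂ) by simp [u],
        Complex.norm_real, Real.norm_of_nonneg (by positivity), div_lt_iff₀ (by positivity)]
      nlinarith [(Nat.cast_nonneg n : (0 : ℝ) ≤ n)]
    have hu : Tendsto u atTop (𝓝[≠] z₀) := by
      refine tendsto_nhdsWithin_iff.2 ⟨?_, Eventually.of_forall hu_ne⟩
      have h1 : Tendsto (fun n : ℕ => r / ((n : ℝ) + 2)) atTop (𝓝 0) :=
        tendsto_const_nhds.div_atTop (tendsto_natCast_atTop_atTop.atTop_add tendsto_const_nhds)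
      have h2 := (Complex.continuous_ofReal.tendsto 0).comp h1
      simpa [u] using tendsto_const_nhds (x := z₀).add h2
    refine aestronglyMeasurable_of_tendsto_ae atTop
      (f := fun n s => (u n - z₀)⁻¹ * (G (u n) (γ.toFun s) * derivWithin γ.toFun (Set.Icc 0 1) s -
        G z₀ (γ.toFun s) * derivWithin γ.toFun (Set.Icc 0 1) s))
      (fun n => ((hmeas _ (hu_mem n)).sub (hmeas _ (Metric.mem_ball_self hr))).const_mul _) ?_
    refine (MeasureTheory.ae_restrict_iff' measurableSet_uIoc).2 (Eventually.of_forall fun s hs => ?_)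
    have h3 := ((hderiv _ (hmem hs) z₀ (Metric.mem_ball_self hr)).tendsto_slope.comp hu).mul_const
      (derivWithin γ.toFun (Set.Icc 0 1) s)
    refine h3.congr fun n => ?_
    simp [slope_def_field]
    ring
  · refine Eventually.of_forall fun s hs z hz => ?_
    rw [norm_mul]
    refine mul_le_mul_of_nonneg_right ?_ (norm_nonneg _)
    have hsub : Metric.closedBall z (r / 2) ⊆ Metric.ball z₀ r := by
      refine Metric.closedBall_subset_ball' ?_
      rw [Metric.mem_ball] at hz
      linarith
    refine Complex.norm_deriv_le_of_forall_mem_sphere_norm_le (half_pos hr) ?_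
      fun y hy => hb _ (hmem hs) y (hsub (Metric.sphere_subset_closedBall hy))
    refine DifferentiableOn.diffContOnCl ?_
    rw [closure_ball _ (half_pos hr).ne']
    exact (hd _ (hmem hs)).mono hsub
  · refine ContinuousOn.intervalIntegrable ?_
    rw [Set.uIcc_of_le zero_le_one]
    exact continuousOn_const.mul γ.continuousOn_derivWithin.norm
  · refine Eventually.of_forall fun s hs z hz => HasDerivAt.mul_const ?_ _
    exact hderiv _ (hmem hs) z (Metric.ball_subset_ball (by linarith) hz)

theorem Cycle.image_subset_trace {C : Cycle} {γ : Loop} (hγ : γ ∈ C.support) :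
    γ.image ⊆ C.trace := Set.subset_biUnion_of_mem (u := fun γ : Loop => γ.image) hγ

theorem Cycle.isCompact_trace (C : Cycle) : IsCompact C.trace :=
  C.support.isCompact_biUnion fun γ _ => γ.isCompact_image

theorem Cycle.trace_add_subset (C D : Cycle) : (C + D).trace ⊆ C.trace ∪ D.trace := by
  classical
  refine Set.iUnion₂_subset fun γ hγ => ?_
  rcases Finset.mem_union.1 (Finsupp.support_add hγ) with h | h
  · exact (Cycle.image_subset_trace h).trans Set.subset_union_left
  · exact (Cycle.image_subset_trace h).trans Set.subset_union_right

theorem Cycle.trace_neg (C : Cycle) : (-C).trace = C.trace := by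
  simp [Cycle.trace, Finsupp.support_neg]

theorem Cycle.trace_sub_subset (C D : Cycle) : (C - D).trace ⊆ C.trace ∪ D.trace := by
  rw [sub_eq_add_neg, ← D.trace_neg]
  exact Cycle.trace_add_subset _ _

theorem Cycle.integral_add (C D : Cycle) (F : ℂ → ℂ) :
    (C + D).integral F = C.integral F + D.integral F :=
  Finsupp.sum_add_index' (by simp) (fun γ m n => by push_cast; ring)

theorem Cycle.integral_sub (C D : Cycle) (F : ℂ → ℂ) :
    (C - D).integral F = C.integral F - D.integral F :=
  Finsupp.sum_sub_index (fun γ m n => by push_cast; ring)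

theorem Cycle.integral_zero (F : ℂ → ℂ) : (0 : Cycle).integral F = 0 := Finsupp.sum_zero_index

theorem Cycle.integral_congr {C : Cycle} {F G : ℂ → ℂ} {N : Set ℂ} (hN : N.Countable)
    (h : ∀ z ∈ C.trace, z ∉ N → F z = G z) : C.integral F = C.integral G :=
  Finset.sum_congr rfl fun γ hγ => by
    beta_reduce
    rw [γ.integral_congr hN fun z hz => h z (Cycle.image_subset_trace hγ hz)]

theorem Cycle.integral_congr_trace {C : Cycle} {F G : ℂ → ℂ} (h : ∀ z ∈ C.trace, F z = G z) :
    C.integral F = C.integral G := Cycle.integral_congr Set.countable_empty fun z hz _ => h z hz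

theorem Cycle.integral_const_mul (C : Cycle) (c : ℂ) (F : ℂ → ℂ) :
    C.integral (fun z => c * F z) = c * C.integral F := by
  simp only [Cycle.integral, Finsupp.sum, Loop.integral, mul_assoc,
    intervalIntegral.integral_const_mul, Finset.mul_sum]
  exact Finset.sum_congr rfl fun γ _ => by ring

theorem Cycle.integral_fun_sub {C : Cycle} {F G : ℂ → ℂ} (hF : ContinuousOn F C.trace)
    (hG : ContinuousOn G C.trace) :
    C.integral (fun z => F z - G z) = C.integral F - C.integral G := by
  simp only [Cycle.integral, Finsupp.sum]
  rw [← Finset.sum_sub_distrib]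
  refine Finset.sum_congr rfl fun γ hγ => ?_
  rw [← mul_sub]
  congr 1
  simp only [Loop.integral, sub_mul]
  exact intervalIntegral.integral_sub
    (γ.intervalIntegrable (hF.mono (Cycle.image_subset_trace hγ)))
    (γ.intervalIntegrable (hG.mono (Cycle.image_subset_trace hγ)))

theorem Cycle.integral_eq_zero_of_hasDerivAt {C : Cycle} {F G : ℂ → ℂ}
    (hF : ContinuousOn F C.trace) (hG : ∀ z ∈ C.trace, HasDerivAt G (F z) z) :
    C.integral F = 0 :=
  Finset.sum_eq_zero fun γ hγ => by
    beta_reduce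
    rw [γ.integral_eq_zero_of_hasDerivAt (hF.mono (Cycle.image_subset_trace hγ))
      fun z hz => hG z (Cycle.image_subset_trace hγ hz), mul_zero]

theorem Cycle.differentiableAt_integral {C : Cycle} {G : ℂ → ℂ → ℂ} {z₀ : ℂ} {r M : ℝ}
    (hr : 0 < r) (hd : ∀ w ∈ C.trace, DifferentiableOn ℂ (fun z => G z w) (Metric.ball z₀ r))
    (hb : ∀ w ∈ C.trace, ∀ z ∈ Metric.ball z₀ r, ‖G z w‖ ≤ M)
    (hc : ∀ z ∈ Metric.ball z₀ r, ContinuousOn (G z) C.trace) :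
    DifferentiableAt ℂ (fun z => C.integral (G z)) z₀ := by
  simp only [Cycle.integral, Finsupp.sum]
  refine DifferentiableAt.fun_sum fun γ hγ => DifferentiableAt.const_mul ?_ _
  have h := Cycle.image_subset_trace hγ
  exact γ.differentiableAt_integral hr (fun w hw => hd w (h hw)) (fun w hw => hb w (h hw))
    fun z hz => (hc z hz).mono h

theorem Loop.exists_norm_integral_le (γ : Loop) : ∃ V : ℝ, 0 ≤ V ∧ ∀ (F : ℂ → ℂ) (M : ℝ),
    (∀ z ∈ γ.image, ‖F z‖ ≤ M) → ‖γ.integral F‖ ≤ M * V := by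
  obtain ⟨V, hV⟩ := isCompact_Icc.exists_bound_of_continuousOn γ.continuousOn_derivWithin
  refine ⟨V, (norm_nonneg _).trans (hV 0 (by simp)), fun F M hM => ?_⟩
  have h := intervalIntegral.norm_integral_le_of_norm_le_const (a := (0 : ℝ)) (b := 1) (C := M * V)
    (f := fun s => F (γ.toFun s) * derivWithin γ.toFun (Set.Icc 0 1) s) fun s hs => by
      rw [Set.uIoc_of_le zero_le_one] at hs
      have hs' := Set.Ioc_subset_Icc_self hs
      have h₁ := hM _ (Set.mem_image_of_mem _ hs')
      rw [norm_mul]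
      exact mul_le_mul h₁ (hV s hs') (norm_nonneg _) ((norm_nonneg _).trans h₁)
  simpa [Loop.integral] using h

theorem Cycle.exists_norm_integral_le (C : Cycle) : ∃ V : ℝ, 0 ≤ V ∧ ∀ (F : ℂ → ℂ) (M : ℝ),
    (∀ z ∈ C.trace, ‖F z‖ ≤ M) → ‖C.integral F‖ ≤ M * V := by
  choose V hV₀ hV using Loop.exists_norm_integral_le
  refine ⟨∑ γ ∈ C.support, ‖(C γ : ℂ)‖ * V γ,
    Finset.sum_nonneg fun γ _ => mul_nonneg (norm_nonneg _) (hV₀ γ), fun F M hM => ?_⟩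
  rw [Finset.mul_sum]
  refine norm_sum_le_of_le _ fun γ hγ => ?_
  rw [norm_mul, mul_left_comm]
  exact mul_le_mul_of_nonneg_left
    (hV γ F M fun z hz => hM z (Cycle.image_subset_trace hγ hz)) (norm_nonneg _)

/-! ### Winding numbers -/

theorem Cycle.winding_eq (C : Cycle) (w : ℂ) :
    C.winding w = (2 * Real.pi * Complex.I)⁻¹ * C.integral fun z => (z - w)⁻¹ := by
  rw [Cycle.winding, ← Cycle.integral_const_mul]
  simp [mul_comm]

theorem Cycle.winding_eq_zero_iff (C : Cycle) (w : ℂ) :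
    C.winding w = 0 ↔ (C.integral fun z => (z - w)⁻¹) = 0 := by
  rw [Cycle.winding_eq, mul_eq_zero, or_iff_right]
  simp [Real.pi_ne_zero]

theorem Cycle.continuousOn_inv_sub {C : Cycle} {w : ℂ} (hw : w ∉ C.trace) :
    ContinuousOn (fun z => (z - w)⁻¹) C.trace :=
  ContinuousOn.inv₀ (by fun_prop) fun z hz e => hw (by rwa [← sub_eq_zero.1 e])

theorem one_sub_mem_slitPlane {x : ℂ} (hx : ‖x‖ < 1) : 1 - x ∈ Complex.slitPlane := by
  rw [sub_eq_add_neg]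
  exact Complex.mem_slitPlane_of_norm_lt_one (by simpa using hx)

/-- On the cycle, log(1 - (w - w₀)/(z - w₀)) is a primitive of 1/(z - w) - 1/(z - w₀); its argument
stays in the slit plane because the quotient has norm less than 1. -/
theorem Cycle.winding_eq_of_norm_lt {C : Cycle} {w w₀ : ℂ}
    (h : ∀ z ∈ C.trace, ‖w - w₀‖ < ‖z - w₀‖) : C.winding w = C.winding w₀ := by
  have h₀ : w₀ ∉ C.trace := fun hw => by simpa using (norm_nonneg _).trans_lt (h _ hw)
  have h₁ : w ∉ C.trace := fun hw => (h _ hw).false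
  rw [Cycle.winding_eq, Cycle.winding_eq]
  congr 1
  rw [← sub_eq_zero, ← Cycle.integral_fun_sub (Cycle.continuousOn_inv_sub h₁)
    (Cycle.continuousOn_inv_sub h₀)]
  refine Cycle.integral_eq_zero_of_hasDerivAt
    (G := fun z => Complex.log (1 - (w - w₀) / (z - w₀)))
    ((Cycle.continuousOn_inv_sub h₁).sub (Cycle.continuousOn_inv_sub h₀)) fun z hz => ?_
  have hz₀ : z - w₀ ≠ 0 := sub_ne_zero.2 fun e => h₀ (e ▸ hz)
  have hz₁ : z - w ≠ 0 := sub_ne_zero.2 fun e => h₁ (e ▸ hz)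
  have hlt : ‖(w - w₀) / (z - w₀)‖ < 1 := by
    rw [norm_div, div_lt_one (norm_pos_iff.2 hz₀)]; exact h z hz
  have hs := one_sub_mem_slitPlane hlt
  have hd : HasDerivAt (fun z => 1 - (w - w₀) / (z - w₀)) ((w - w₀) / (z - w₀) ^ 2) z := by
    refine (((hasDerivAt_const z (w - w₀)).fun_div ((hasDerivAt_id z).sub_const w₀)
      hz₀).const_sub 1).congr_deriv ?_
    simp only [id]
    ring
  convert hd.clog hs using 1
  have e : 1 - (w - w₀) / (z - w₀) = (z - w) / (z - w₀) := by field_simp; ring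
  rw [e]
  field_simp
  ring

/-- Here log(1 - z/w) is a primitive of 1/(z - w) on the cycle. -/
theorem Cycle.winding_eq_zero_of_norm_lt {C : Cycle} {w : ℂ} (h : ∀ z ∈ C.trace, ‖z‖ < ‖w‖) :
    C.winding w = 0 := by
  have h₁ : w ∉ C.trace := fun hw => (h _ hw).false
  rw [Cycle.winding_eq_zero_iff]
  refine Cycle.integral_eq_zero_of_hasDerivAt (G := fun z => Complex.log (1 - z / w))
    (Cycle.continuousOn_inv_sub h₁) fun z hz => ?_
  have hw : w ≠ 0 := fun e => by
    have := (norm_nonneg _).trans_lt (h z hz)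
    simp [e] at this
  have hz₁ : z - w ≠ 0 := sub_ne_zero.2 fun e => h₁ (e ▸ hz)
  have hlt : ‖z / w‖ < 1 := by rw [norm_div, div_lt_one (norm_pos_iff.2 hw)]; exact h z hz
  have hd : HasDerivAt (fun z => 1 - z / w) (-(1 / w)) z :=
    ((hasDerivAt_id z).div_const w).const_sub 1
  convert hd.clog (one_sub_mem_slitPlane hlt) using 1
  have e : 1 - z / w = -(z - w) / w := by field_simp; ring
  rw [e]
  field_simp

theorem Cycle.eventually_winding_eq {C : Cycle} {w₀ : ℂ} (h : w₀ ∉ C.trace) :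
    ∀ᶠ w in 𝓝 w₀, w ∉ C.trace ∧ C.winding w = C.winding w₀ := by
  obtain ⟨ε, hε, hb⟩ := Metric.isOpen_iff.1 C.isCompact_trace.isClosed.isOpen_compl w₀ h
  filter_upwards [Metric.ball_mem_nhds w₀ hε] with w hw
  refine ⟨hb hw, Cycle.winding_eq_of_norm_lt fun z hz => ?_⟩
  by_contra! hle
  refine hb (mem_ball_iff_norm.2 (hle.trans_lt (mem_ball_iff_norm.1 hw))) hz

theorem Cycle.exists_norm_lt (C : Cycle) : ∃ R : ℝ, 0 < R ∧ ∀ z ∈ C.trace, ‖z‖ < R := by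
  obtain ⟨R, hR⟩ := C.isCompact_trace.isBounded.exists_norm_le
  exact ⟨max R 0 + 1, by positivity, fun z hz => by linarith [hR z hz, le_max_left R 0]⟩

/-! ### Cauchy's theorem for cycles -/

/-- For `w` near z₀ the mean value inequality bounds the slope by the derivative on a disc; for `w`
outside that disc the denominator is at least r. -/
theorem exists_norm_dslope_le {U : Set ℂ} (hU : IsOpen U) {F : ℂ → ℂ} (hF : DifferentiableOn ℂ F U)
    {K : Set ℂ} (hK : IsCompact K) (hKU : K ⊆ U) {z₀ : ℂ} (hz₀ : z₀ ∈ U) :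
    ∃ r > 0, ∃ M : ℝ, Metric.ball z₀ r ⊆ U ∧
      ∀ w ∈ K, ∀ z ∈ Metric.ball z₀ r, ‖dslope F w z‖ ≤ M := by
  obtain ⟨ε, hε, hεU⟩ := Metric.isOpen_iff.1 hU z₀ hz₀
  set r := ε / 3 with hr
  have hr₀ : 0 < r := by positivity
  have hsub : Metric.closedBall z₀ (2 * r) ⊆ U :=
    (Metric.closedBall_subset_ball (by linarith)).trans hεU
  obtain ⟨M₁, hM₁⟩ := (isCompact_closedBall z₀ (2 * r)).exists_bound_of_continuousOn
    ((hF.deriv hU).continuousOn.mono hsub)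
  obtain ⟨M₂, hM₂⟩ := (isCompact_closedBall z₀ (2 * r)).exists_bound_of_continuousOn
    (hF.continuousOn.mono hsub)
  obtain ⟨M₃, hM₃⟩ := hK.exists_bound_of_continuousOn (hF.continuousOn.mono hKU)
  refine ⟨r, hr₀, max M₁ ((M₂ + M₃) / r), (Metric.ball_subset_ball (by linarith)).trans hεU,
    fun w hw z hz => ?_⟩
  have hz' : z ∈ Metric.closedBall z₀ (2 * r) :=
    Metric.ball_subset_closedBall (Metric.ball_subset_ball (by linarith) hz)
  rcases eq_or_ne z w with rfl | hne
  · rw [dslope_same]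
    exact (hM₁ _ hz').trans (le_max_left _ _)
  have hne' : 0 < ‖z - w‖ := norm_pos_iff.2 (sub_ne_zero.2 hne)
  rw [dslope_of_ne _ hne, slope_def_field, norm_div]
  by_cases hw' : w ∈ Metric.closedBall z₀ (2 * r)
  · refine le_max_of_le_left ((div_le_iff₀ hne').2 ?_)
    exact (convex_closedBall z₀ (2 * r)).norm_image_sub_le_of_norm_deriv_le
      (fun x hx => hF.differentiableAt (hU.mem_nhds (hsub hx))) hM₁ hw' hz'
  · refine le_max_of_le_right ?_
    have hle : r ≤ ‖z - w‖ := by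
      rw [Metric.mem_closedBall, not_le] at hw'
      rw [Metric.mem_ball] at hz
      have := dist_triangle w z z₀
      rw [dist_comm w z, dist_eq_norm z w] at this
      linarith
    refine div_le_div₀ ?_ ((norm_sub_le _ _).trans (add_le_add (hM₂ z hz') (hM₃ w hw))) hr₀ hle
    exact add_nonneg ((norm_nonneg _).trans (hM₂ z hz')) ((norm_nonneg _).trans (hM₃ w hw))

theorem Cycle.integral_dslope {C : Cycle} {F : ℂ → ℂ} (hF : ContinuousOn F C.trace) {z : ℂ}
    (hz : z ∉ C.trace) (hw : C.winding z = 0) :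
    C.integral (fun w => dslope F w z) = C.integral fun w => F w * (w - z)⁻¹ := by
  have hc := Cycle.continuousOn_inv_sub hz
  have e : C.integral (fun w => dslope F w z) =
      C.integral fun w => F w * (w - z)⁻¹ - F z * (w - z)⁻¹ := by
    refine Cycle.integral_congr_trace fun w hwC => ?_
    have hne : z ≠ w := fun e => hz (e ▸ hwC)
    have h1 : z - w ≠ 0 := sub_ne_zero.2 hne
    have h2 : w - z ≠ 0 := sub_ne_zero.2 hne.symm
    rw [dslope_of_ne _ hne, slope_def_field]
    field_simp
    ring
  rw [e, Cycle.integral_fun_sub (hF.fun_mul hc) (continuousOn_const.fun_mul hc),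
    Cycle.integral_const_mul, (C.winding_eq_zero_iff z).1 hw, mul_zero, sub_zero]

/-- The integral of `F w / (w - z)` vanishes for `z` outside the cycle. -/
theorem Cycle.integral_div_sub_eq_zero {C : Cycle} {U : Set ℂ} (hU : IsOpen U) {F : ℂ → ℂ}
    (hF : DifferentiableOn ℂ F U) (hC : C.trace ⊆ U) (hw : ∀ w ∉ U, C.winding w = 0) {z : ℂ}
    (hz : z ∉ C.trace) (hz' : C.winding z = 0) :
    (C.integral fun w => F w * (w - z)⁻¹) = 0 := by
  classical
  have hFC := hF.continuousOn.mono hC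
  -- Dixon's function. The two formulas agree off the cycle wherever the winding number is zero, so
  -- they glue to an entire function. It tends to 0 at infinity and vanishes by Liouville's theorem.
  let h : ℂ → ℂ := fun z => if z ∈ U then C.integral (fun w => dslope F w z) else
    C.integral fun w => F w * (w - z)⁻¹
  have hout : ∀ z ∉ C.trace, C.winding z = 0 → h z = C.integral fun w => F w * (w - z)⁻¹ := by
    intro z h₁ h₂
    by_cases hzU : z ∈ U
    · simp only [h, if_pos hzU, Cycle.integral_dslope hFC h₁ h₂]
    · simp only [h, if_neg hzU]
  obtain ⟨R, hR₀, hR⟩ := C.exists_norm_lt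
  have hdiff : Differentiable ℂ h := by
    intro z₀
    by_cases hz₀ : z₀ ∈ U
    · obtain ⟨r, hr, M, hrU, hM⟩ := exists_norm_dslope_le hU hF C.isCompact_trace hC hz₀
      refine (Cycle.differentiableAt_integral (C := C) (G := fun z w => dslope F w z) hr
        (fun w hwC => ?_) hM fun z hz => ?_).congr_of_eventuallyEq ?_
      · exact ((Complex.differentiableOn_dslope (hU.mem_nhds (hC hwC))).2 hF).mono hrU
      · refine (((Complex.differentiableOn_dslope (hU.mem_nhds (hrU hz))).2
          hF).continuousOn.mono hC).congr fun w hwC => ?_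
        rcases eq_or_ne w z with rfl | hne
        · rfl
        · rw [dslope_of_ne _ hne, dslope_of_ne _ hne.symm, slope_comm]
      · filter_upwards [hU.mem_nhds hz₀] with z hz
        simp only [h, if_pos hz]
    -- Outside `U` the winding number is zero, and it is locally constant, so the second formula is
    -- valid on a whole neighbourhood of z₀.
    · have hzC : z₀ ∉ C.trace := fun h => hz₀ (hC h)
      obtain ⟨ε, hε, hb⟩ := Metric.isOpen_iff.1 C.isCompact_trace.isClosed.isOpen_compl z₀ hzC
      obtain ⟨M, hM⟩ := C.isCompact_trace.exists_bound_of_continuousOn hFC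
      have hne : ∀ w ∈ C.trace, ∀ z ∈ Metric.ball z₀ (ε / 2), ε / 2 ≤ ‖w - z‖ := by
        intro w hwC z hz
        by_contra! hlt
        refine hb (?_ : w ∈ Metric.ball z₀ ε) hwC
        rw [Metric.mem_ball] at hz ⊢
        rw [← dist_eq_norm] at hlt
        linarith [dist_triangle w z z₀]
      have hne0 : ∀ w ∈ C.trace, ∀ z ∈ Metric.ball z₀ (ε / 2), w - z ≠ 0 := fun w hw z hz =>
        norm_pos_iff.1 ((half_pos hε).trans_le (hne w hw z hz))
      refine (Cycle.differentiableAt_integral (C := C) (G := fun z w => F w * (w - z)⁻¹)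
        (half_pos hε) (M := M * (ε / 2)⁻¹) (fun w hwC => ?_) (fun w hwC z hz => ?_)
        fun z hz => ?_).congr_of_eventuallyEq ?_
      · exact (differentiableOn_const _).mul
          (DifferentiableOn.fun_inv (by fun_prop) fun z hz => hne0 w hwC z hz)
      · rw [norm_mul, norm_inv]
        have := hne w hwC z hz
        have := (norm_nonneg _).trans (hM w hwC)
        gcongr
        exact hM w hwC
      · exact hFC.mul (Cycle.continuousOn_inv_sub fun hzC => by simpa using hne0 z hzC z hz)
      · filter_upwards [Cycle.eventually_winding_eq hzC] with z hz
        exact hout z hz.1 (hz.2.trans (hw z₀ hz₀))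
  have hlim : Tendsto h (cocompact ℂ) (𝓝 0) := by
    obtain ⟨M, hM⟩ := C.isCompact_trace.exists_bound_of_continuousOn hFC
    obtain ⟨V, -, hV⟩ := C.exists_norm_integral_le
    have hz : Tendsto (fun z : ℂ => M * (‖z‖ - R)⁻¹ * V) (cocompact ℂ) (𝓝 0) := by
      simpa [← sub_eq_add_neg] using ((tendsto_inv_atTop_zero.comp (tendsto_atTop_add_const_right _ (-R)
        (tendsto_norm_cocompact_atTop (E := ℂ)))).const_mul M).mul_const V
    refine squeeze_zero_norm' ?_ hz
    filter_upwards [(tendsto_norm_cocompact_atTop (E := ℂ)).eventually_gt_atTop R] with z hzR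
    have hlt : ∀ w ∈ C.trace, ‖w‖ < ‖z‖ := fun w hw => (hR w hw).trans hzR
    rw [hout z (fun hzC => (hlt z hzC).false) (Cycle.winding_eq_zero_of_norm_lt hlt)]
    refine hV _ _ fun w hw => ?_
    have h₁ := hM w hw
    have h₂ : ‖z‖ - R ≤ ‖w - z‖ := by
      rw [norm_sub_rev]
      linarith [norm_sub_norm_le z w, hR w hw]
    have h₃ := (norm_nonneg _).trans h₁
    have h₄ : 0 < ‖z‖ - R := sub_pos.2 hzR
    rw [norm_mul, norm_inv]
    gcongr
  rw [← hout z hz hz']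
  exact hdiff.apply_eq_of_tendsto_cocompact z hlim

/-- **Cauchy's integral theorem** for a cycle in an open set that winds around no point outside
the set. -/
theorem Cycle.integral_eq_zero_of_winding_eq_zero {C : Cycle} {U : Set ℂ} (hU : IsOpen U)
    {F : ℂ → ℂ} (hF : DifferentiableOn ℂ F U) (hC : C.trace ⊆ U)
    (hw : ∀ w ∉ U, C.winding w = 0) : C.integral F = 0 := by
  obtain ⟨R, hR₀, hR⟩ := C.exists_norm_lt
  have hlt : ∀ z ∈ C.trace, ‖z‖ < ‖(R : ℂ)‖ := fun z hz => by
    rw [Complex.norm_real, Real.norm_of_nonneg hR₀.le]; exact hR z hz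
  have hRC : (R : ℂ) ∉ C.trace := fun h => (hlt _ h).false
  -- The integrand F is F(w)(w - R)/(w - R), a Cauchy-type integral for F(w)(w - R) at a point R
  -- beyond the cycle.
  rw [← Cycle.integral_div_sub_eq_zero hU (F := fun w => F w * (w - R)) (by fun_prop) hC hw hRC
    (Cycle.winding_eq_zero_of_norm_lt hlt)]
  refine Cycle.integral_congr_trace fun z hz => ?_
  have : z - R ≠ 0 := sub_ne_zero.2 fun e => hRC (e ▸ hz)
  field_simp

/-! ### Circles -/

/-- The positively oriented circle around `c` of radius `r`. -/
noncomputable def circleLoop (c : ℂ) (r : ℝ) : Loop where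
  toFun s := circleMap c r (2 * Real.pi * s)
  contDiffOn := ((contDiff_circleMap c r).comp (contDiff_const.mul contDiff_id)).contDiffOn
  closed := by simp [circleMap]

theorem circleLoop_zero_one : circleLoop 0 1 = unitLoop := by
  simp [circleLoop, unitLoop, circleMap, mul_right_comm]

theorem circleLoop_image_subset (c : ℂ) {r : ℝ} (hr : 0 ≤ r) :
    (circleLoop c r).image ⊆ Metric.sphere c r := by
  rintro _ ⟨s, -, rfl⟩
  exact circleMap_mem_sphere c hr _

theorem circleLoop_integral (c : ℂ) (r : ℝ) (F : ℂ → ℂ) :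
    (circleLoop c r).integral F = ∮ z in C(c, r), F z := by
  have h := intervalIntegral.smul_integral_comp_mul_left (a := 0) (b := 1)
    (f := fun θ => deriv (circleMap c r) θ • F (circleMap c r θ)) (c := 2 * Real.pi)
  rw [mul_zero, mul_one, ← intervalIntegral.integral_smul] at h
  rw [circleIntegral, ← h]
  refine intervalIntegral.integral_congr fun s hs => ?_
  rw [Set.uIcc_of_le zero_le_one] at hs
  have hd : HasDerivAt (circleLoop c r).toFun
      ((2 * Real.pi) • deriv (circleMap c r) (2 * Real.pi * s)) s := by
    have h₁ : HasDerivAt (fun s : ℝ => 2 * Real.pi * s) (2 * Real.pi) s := by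
      simpa using (hasDerivAt_id s).const_mul (2 * Real.pi)
    exact (differentiable_circleMap c r _).hasDerivAt.scomp s h₁
  rw [hd.hasDerivWithinAt.derivWithin (uniqueDiffOn_Icc zero_lt_one s hs), mul_comm,
    smul_mul_assoc]
  rfl

theorem trace_single (γ : Loop) : Cycle.trace (Finsupp.single γ 1) = γ.image := by
  simp [Cycle.trace]

theorem winding_circleLoop_of_lt {c w : ℂ} {r : ℝ} (h : ‖w - c‖ < r) :
    Cycle.winding (Finsupp.single (circleLoop c r) 1) w = 1 := by
  rw [Cycle.winding_eq, Cycle.integral, Finsupp.sum_single_index (by simp), circleLoop_integral,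
    circleIntegral.integral_sub_inv_of_mem_ball (mem_ball_iff_norm.2 h)]
  rw [Int.cast_one, one_mul]
  exact inv_mul_cancel₀ Complex.two_pi_I_ne_zero

theorem winding_circleLoop_of_gt {c w : ℂ} {r : ℝ} (hr : 0 ≤ r) (h : r < ‖w - c‖) :
    Cycle.winding (Finsupp.single (circleLoop c r) 1) w = 0 := by
  rw [Cycle.winding_eq, Cycle.integral, Finsupp.sum_single_index (by simp), circleLoop_integral,
    Complex.circleIntegral_eq_zero_of_differentiable_on_off_countable hr Set.countable_empty]
  · simp
  all_goals
    have hne : ∀ z ∈ Metric.closedBall c r, z - w ≠ 0 := fun z hz e => by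
      rw [mem_closedBall_iff_norm, sub_eq_zero.1 e] at hz
      linarith
  · exact ContinuousOn.inv₀ (by fun_prop) hne
  · intro z hz
    exact DifferentiableAt.fun_inv (by fun_prop) (hne z (Metric.ball_subset_closedBall hz.1))

/-! ### Existence and persistence of contours -/

theorem Cycle.winding_add (C D : Cycle) (w : ℂ) :
    (C + D).winding w = C.winding w + D.winding w := Cycle.integral_add C D _

theorem Cycle.winding_sub (C D : Cycle) (w : ℂ) :
    (C - D).winding w = C.winding w - D.winding w := Cycle.integral_sub C D _

/-- Take a sum of circles around the points of `S`, each so small that its closed disc meets `X` at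
most in its centre. -/
theorem exists_cycle_indicator {X : Set ℂ} {S : Finset ℂ}
    (h : ∀ w ∈ S, ∃ δ > 0, ∀ x ∈ X, x ≠ w → δ < ‖x - w‖) :
    ∃ D : Cycle, ∀ x ∈ X, x ∉ D.trace ∧ D.winding x = if x ∈ S then 1 else 0 := by
  classical
  induction S using Finset.induction_on with
  | empty =>
    exact ⟨0, fun x _ => ⟨by simp [Cycle.trace], by simp [Cycle.winding, Cycle.integral_zero]⟩⟩
  | insert w S hw ih =>
    obtain ⟨D, hD⟩ := ih fun w' h' => h w' (Finset.mem_insert_of_mem h')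
    obtain ⟨δ, hδ, hδX⟩ := h w (Finset.mem_insert_self _ _)
    refine ⟨Finsupp.single (circleLoop w δ) 1 + D, fun x hx => ?_⟩
    obtain ⟨h₁, h₂⟩ := hD x hx
    have h₃ : x ∉ Cycle.trace (Finsupp.single (circleLoop w δ) 1) := fun hxt => by
      rw [trace_single] at hxt
      have h₄ := circleLoop_image_subset w hδ.le hxt
      rw [mem_sphere_iff_norm] at h₄
      rcases eq_or_ne x w with rfl | hne
      · simp at h₄
        exact hδ.ne h₄
      · exact (hδX x hx hne).ne' h₄
    refine ⟨fun hxt => (Cycle.trace_add_subset _ _ hxt).elim h₃ h₁, ?_⟩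
    rw [Cycle.winding_add, h₂]
    rcases eq_or_ne x w with rfl | hne
    · rw [winding_circleLoop_of_lt (by simpa using hδ)]
      simp [hw]
    · rw [winding_circleLoop_of_gt hδ.le (hδX x hx hne)]
      simp [hne]

/-- The contour is a circle of radius ε around 0, inside which there are no reciprocals of points of
`W`, together with a small circle around each of the finitely many points of `W` of norm at least ε.
-/
theorem exists_isContour {W : Set ℂ} (h₀ : (0 : ℂ) ∉ W)
    (hfin : ∀ ε > 0, {w ∈ W | ε ≤ ‖w‖}.Finite) (hinv : ∀ w ∈ W, ∀ w' ∈ W, w * w' ≠ 1) :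
    ∃ C : Cycle, IsContour W C := by
  classical
  have hne : ∀ w ∈ W, w ≠ 0 := fun w hw e => h₀ (e ▸ hw)
  obtain ⟨R, hR₁, hR⟩ : ∃ R : ℝ, 1 ≤ R ∧ ∀ w ∈ W, ‖w‖ ≤ R := by
    obtain ⟨R, hR⟩ := (hfin 1 one_pos).isBounded.exists_norm_le
    refine ⟨max R 1, le_max_right _ _, fun w hw => ?_⟩
    by_cases h : 1 ≤ ‖w‖
    · exact (hR w ⟨hw, h⟩).trans (le_max_left _ _)
    · exact (not_le.1 h).le.trans (le_max_right _ _)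
  have hR₀ : 0 < R⁻¹ := inv_pos.2 (one_pos.trans_le hR₁)
  -- Reciprocals of points of `W` have norm at least R⁻¹ > ε. Only finitely many norms of points of
  -- `W` lie in the interval, so the circle of radius ε can avoid `W`.
  obtain ⟨ε, ⟨hε₁, hε₂⟩, hε⟩ : ∃ ε ∈ Set.Ioo (R⁻¹ / 2) R⁻¹, ε ∉ norm '' {w ∈ W | R⁻¹ / 2 ≤ ‖w‖} :=
    ((Set.Ioo_infinite (half_lt_self hR₀)).sdiff ((hfin _ (half_pos hR₀)).image norm)).nonempty
  have hε₀ : 0 < ε := (half_pos hR₀).trans hε₁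
  have hεW : ∀ w ∈ W, ‖w‖ ≠ ε := fun w hw e => hε ⟨w, ⟨hw, e ▸ hε₁.le⟩, e⟩
  have hεinv : ∀ w ∈ W, ε < ‖w⁻¹‖ := fun w hw => by
    rw [norm_inv]
    exact hε₂.trans_le (inv_anti₀ (norm_pos_iff.2 (hne w hw)) (hR w hw))
  set X : Set ℂ := insert 0 (W ∪ {x | x⁻¹ ∈ W}) with hX
  have hinvX : ∀ w ∈ W, w⁻¹ ∈ X := fun w hw => Or.inr (Or.inr (by simpa using hw))
  have hWX : ∀ w ∈ W, w ∈ X := fun w hw => Or.inr (Or.inl hw)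
  have hsep : ∀ w : ℂ, w ≠ 0 → ∃ δ > 0, ∀ x ∈ X, x ≠ w → δ < ‖x - w‖ := by
    intro w hw
    have hw' : 0 < ‖w‖ := norm_pos_iff.2 hw
    have hXf : {x ∈ X | x ∈ Metric.ball w (‖w‖ / 2)}.Finite := by
      refine ((hfin _ (half_pos hw')).union
        (((hfin (2 * ‖w‖)⁻¹ (by positivity)).image (·⁻¹)))).subset ?_
      rintro x ⟨hx, hxw⟩
      rw [mem_ball_iff_norm] at hxw
      have h₁ : ‖w‖ / 2 ≤ ‖x‖ := by
        rw [norm_sub_rev] at hxw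
        linarith [norm_sub_norm_le w x]
      have h₂ : ‖x‖ ≤ 2 * ‖w‖ := by linarith [norm_sub_norm_le x w]
      rcases hx with rfl | hx | hx
      · rw [norm_zero] at h₁
        linarith
      · exact Or.inl ⟨hx, h₁⟩
      · refine Or.inr ⟨x⁻¹, ⟨hx, ?_⟩, inv_inv x⟩
        rw [norm_inv]
        exact inv_anti₀ (by linarith) h₂
    obtain ⟨δ, hδ, hδX⟩ := Metric.isOpen_iff.1
      (hXf.subset (Set.sdiff_subset (t := {w}))).isClosed.isOpen_compl w (by simp)
    refine ⟨min δ (‖w‖ / 2) / 2, by positivity, fun x hx hxw => ?_⟩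
    by_contra! hle
    have h₃ : ‖x - w‖ < min δ (‖w‖ / 2) := hle.trans_lt (half_lt_self (by positivity))
    exact hδX (mem_ball_iff_norm.2 (h₃.trans_le (min_le_left _ _)))
      ⟨⟨hx, mem_ball_iff_norm.2 (h₃.trans_le (min_le_right _ _))⟩, hxw⟩
  obtain ⟨D, hD⟩ := exists_cycle_indicator (X := X) (S := (hfin ε hε₀).toFinset)
    fun w hw => hsep w (hne w ((hfin ε hε₀).mem_toFinset.1 hw).1)
  have hXε : ∀ x ∈ X, ‖x‖ ≠ ε := by
    rintro x (rfl | hx | hx)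
    · simpa using hε₀.ne
    · exact hεW x hx
    · simpa using (hεinv _ hx).ne'
  have key : ∀ x ∈ X, x ∉ (Finsupp.single (circleLoop 0 ε) 1 + D : Cycle).trace ∧
      (Finsupp.single (circleLoop 0 ε) 1 + D : Cycle).winding x =
        (if ‖x‖ < ε then 1 else 0) + if x ∈ W ∧ ε ≤ ‖x‖ then 1 else 0 := by
    intro x hx
    obtain ⟨h₁, h₂⟩ := hD x hx
    constructor
    · intro hxt
      refine (Cycle.trace_add_subset _ _ hxt).elim (fun h => ?_) h₁
      rw [trace_single] at h
      simpa [hXε x hx] using circleLoop_image_subset 0 hε₀.le h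
    · rw [Cycle.winding_add, h₂]
      congr 1
      · split_ifs with hlt
        · exact winding_circleLoop_of_lt (by simpa using hlt)
        · refine winding_circleLoop_of_gt hε₀.le ?_
          simpa using lt_of_le_of_ne (not_lt.1 hlt) (hXε x hx).symm
      · simp
  refine ⟨_, (key 0 (Or.inl rfl)).1, ?_, fun w hw => (key w (hWX w hw)).1, fun w hw => ?_,
    fun w hw => (key _ (hinvX w hw)).1, fun w hw => ?_⟩
  · rw [(key 0 (Or.inl rfl)).2]
    simp [hε₀, h₀]
  · rw [(key w (hWX w hw)).2]
    by_cases h : ‖w‖ < ε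
    · simp [h, not_le.2 h]
    · simp [h, not_lt.1 h, hw]
  · rw [(key _ (hinvX w hw)).2, if_neg (hεinv w hw).not_gt, if_neg, add_zero]
    exact fun h => hinv w hw _ h.1 (mul_inv_cancel₀ (hne w hw))

/-- New points close to 0 have the winding number of 0, which is 1, and their reciprocals lie beyond
the cycle, where it is 0. -/
theorem IsContour.exists_forall_norm_lt {W : Set ℂ} {C : Cycle} (h : IsContour W C) :
    ∃ ε > 0, ∀ W' : Set ℂ, (∀ w ∈ W', w ≠ 0 ∧ (w ∈ W ∨ ‖w‖ < ε)) → IsContour W' C := by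
  obtain ⟨δ, hδ, hδC⟩ := Metric.isOpen_iff.1 C.isCompact_trace.isClosed.isOpen_compl 0 h.zero_notMem
  obtain ⟨R, hR₀, hR⟩ := C.exists_norm_lt
  have hδ' : ∀ z ∈ C.trace, δ ≤ ‖z‖ := fun z hz => by
    by_contra! hlt
    exact hδC (by simpa using hlt) hz
  have hsmall : ∀ w : ℂ, ‖w‖ < δ → w ∉ C.trace ∧ C.winding w = 1 := fun w hw =>
    ⟨fun hwC => (hδ' w hwC).not_gt hw, by
      rw [← h.winding_zero]
      exact Cycle.winding_eq_of_norm_lt fun z hz => by simpa using hw.trans_le (hδ' z hz)⟩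
  have hlarge : ∀ w : ℂ, w ≠ 0 → ‖w‖ < R⁻¹ → w⁻¹ ∉ C.trace ∧ C.winding w⁻¹ = 0 :=
    fun w hw hwR => by
      have : R < ‖w⁻¹‖ := by
        rw [norm_inv]
        exact (lt_inv_comm₀ (norm_pos_iff.2 hw) hR₀).1 hwR
      exact ⟨fun hwC => ((hR _ hwC).trans this).false,
        Cycle.winding_eq_zero_of_norm_lt fun z hz => (hR z hz).trans this⟩
  refine ⟨min δ R⁻¹, by positivity, fun W' hW' => ⟨h.zero_notMem, h.winding_zero, ?_, ?_, ?_, ?_⟩⟩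
  all_goals
    intro w hw
    obtain ⟨hw₀, hw | hw⟩ := hW' w hw
  · exact h.notMem w hw
  · exact (hsmall w (hw.trans_le (min_le_left _ _))).1
  · exact h.winding_eq_one w hw
  · exact (hsmall w (hw.trans_le (min_le_left _ _))).2
  · exact h.inv_notMem w hw
  · exact (hlarge w hw₀ (hw.trans_le (min_le_right _ _))).1
  · exact h.winding_inv_eq_zero w hw
  · exact (hlarge w hw₀ (hw.trans_le (min_le_right _ _))).2

theorem isContour_unitCircle {W : Set ℂ} (h : ∀ w ∈ W, w ≠ 0 ∧ ‖w‖ < 1) :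
    IsContour W unitCircle := by
  have htr : unitCircle.trace ⊆ {z | ‖z‖ = 1} := by
    rw [unitCircle, trace_single, ← circleLoop_zero_one]
    exact (circleLoop_image_subset 0 zero_le_one).trans fun z hz => by simpa using hz
  have hin : ∀ w : ℂ, ‖w‖ < 1 → unitCircle.winding w = 1 := fun w hw => by
    rw [unitCircle, ← circleLoop_zero_one]
    exact winding_circleLoop_of_lt (by simpa using hw)
  have hinv : ∀ w ∈ W, 1 < ‖w⁻¹‖ := fun w hw => by
    rw [norm_inv]
    exact (one_lt_inv₀ (norm_pos_iff.2 (h w hw).1)).2 (h w hw).2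
  refine ⟨fun h0 => by simpa using htr h0, hin 0 (by simp), fun w hw hwt => ?_,
    fun w hw => hin w (h w hw).2, fun w hw hwt => ?_, fun w hw => ?_⟩
  · exact (h w hw).2.ne (htr hwt)
  · exact (hinv w hw).ne' (htr hwt)
  · rw [unitCircle, ← circleLoop_zero_one]
    exact winding_circleLoop_of_gt zero_le_one (by simpa using hinv w hw)

/-! ### Powers of `p` as `p → 0` -/

theorem norm_pPow (L : ℂ) (a : ℝ) : ‖pPow L a‖ = Real.exp (a * L.re) := by
  simp [pPow, Complex.norm_exp]

theorem pPow_ne_zero (L : ℂ) (a : ℝ) : pPow L a ≠ 0 := Complex.exp_ne_zero _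

@[simp] theorem pPow_zero (L : ℂ) : pPow L 0 = 1 := by simp [pPow]

@[simp] theorem pPow_one (L : ℂ) : pPow L 1 = Complex.exp L := by simp [pPow]

theorem pPow_add (L : ℂ) (a b : ℝ) : pPow L (a + b) = pPow L a * pPow L b := by
  rw [pPow, pPow, pPow, ← Complex.exp_add]
  congr 1
  push_cast
  ring

theorem pPow_one_sub (L : ℂ) (a : ℝ) : pPow L (1 - a) = Complex.exp L / pPow L a := by
  rw [eq_div_iff (pPow_ne_zero L a), ← pPow_add, sub_add_cancel, pPow_one]

theorem tendsto_re_pToZero : Tendsto Complex.re pToZero atBot := tendsto_comap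

instance : pToZero.IsCountablyGenerated := by
  unfold pToZero
  infer_instance

theorem tendsto_pPow {a : ℝ} (ha : 0 ≤ a) :
    Tendsto (fun L => pPow L a) pToZero (𝓝 (if a = 0 then 1 else 0)) := by
  split_ifs with h
  · simpa [h] using tendsto_const_nhds
  · refine tendsto_zero_iff_norm_tendsto_zero.2 ?_
    simp only [norm_pPow]
    exact Real.tendsto_exp_atBot.comp
      (tendsto_re_pToZero.const_mul_atBot (lt_of_le_of_ne ha (Ne.symm h)))

theorem tendsto_exp_pToZero : Tendsto Complex.exp pToZero (𝓝 0) := by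
  simpa using tendsto_pPow zero_le_one

theorem eventually_norm_exp_lt_one : ∀ᶠ L in pToZero, ‖Complex.exp L‖ < 1 := by
  simpa using tendsto_exp_pToZero.norm.eventually (gt_mem_nhds (by simp : ‖(0 : ℂ)‖ < 1))

/-! ### Locally uniform estimates -/

/-- The tube lemma for filters. -/
theorem eventually_forall_of_compact {X : Type*} {l : Filter X} {K : Set ℂ} (hK : IsCompact K)
    {P : X × ℂ → Prop} (h : ∀ z ∈ K, ∀ᶠ x in l ×ˢ 𝓝 z, P x) : ∀ᶠ L in l, ∀ z ∈ K, P (L, z) := by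
  obtain ⟨s, hs, t, ht, hst⟩ := Filter.mem_prod_iff.1
    (hK.mem_prod_nhdsSet_of_forall (s := {x | P x}) h)
  filter_upwards [hs] with L hL z hz
  exact hst (Set.mk_mem_prod hL (subset_of_mem_nhdsSet ht hz))

theorem exists_bound_of_compact {X : Type*} {l : Filter X} {K : Set ℂ} (hK : IsCompact K)
    {Φ : X → ℂ → ℂ} (h : ∀ z ∈ K, (fun x : X × ℂ => Φ x.1 x.2) =O[l ×ˢ 𝓝 z] fun _ => (1 : ℝ)) :
    ∃ M : ℝ, ∀ᶠ L in l, ∀ z ∈ K, ‖Φ L z‖ ≤ M := by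
  refine hK.induction_on (p := fun s => ∃ M : ℝ, ∀ᶠ L in l, ∀ z ∈ s, ‖Φ L z‖ ≤ M)
    ⟨0, by simp⟩ (fun s t hst ⟨M, hM⟩ => ⟨M, hM.mono fun L hL z hz => hL z (hst hz)⟩)
    (fun s t ⟨M, hM⟩ ⟨M', hM'⟩ => ⟨max M M', ?_⟩) fun z hz => ?_
  · filter_upwards [hM, hM'] with L h₁ h₂ z hz
    exact hz.elim (fun hz => (h₁ z hz).trans (le_max_left _ _))
      fun hz => (h₂ z hz).trans (le_max_right _ _)
  · obtain ⟨M, hM⟩ := (h z hz).bound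
    obtain ⟨s, hs, t, ht, hst⟩ := Filter.mem_prod_iff.1 hM
    refine ⟨t, mem_nhdsWithin_of_mem_nhds ht, M, ?_⟩
    filter_upwards [hs] with L hL w hw
    simpa using hst (Set.mk_mem_prod hL hw)

theorem continuousAt_evalAt {r : RatFunc ℂ} {z : ℂ} (h : r.denom.eval z ≠ 0) :
    ContinuousAt (fun z => evalAt z r) z := by
  simp only [evalAt, RatFunc.eval, Polynomial.eval₂_id]
  exact (r.num.continuous.continuousAt).div r.denom.continuous.continuousAt h

/-- A partial sum is finite, and in the limit every term with τ > val S vanishes, leaving the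
leading one. -/
theorem tendsto_partialSum {S : HahnSeries ℝ (RatFunc ℂ)} (hS : MemF S) {z₀ : ℂ}
    (hz₀ : ∀ τ ∈ S.support, (S.coeff τ).denom.eval z₀ ≠ 0) {B : ℝ} (hB : S.order ≤ B) :
    Tendsto (fun x : ℂ × ℂ => partialSum S B x.1 x.2) (pToZero ×ˢ 𝓝 z₀)
      (𝓝 (evalAt z₀ S.leadingCoeff)) := by
  have e : ∀ L z : ℂ, partialSum S B L z =
      ∑ τ ∈ (hS B).toFinset, evalAt z (S.coeff τ) * pPow L (τ - S.order) := fun L z =>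
    finsum_mem_eq_finite_toFinset_sum _ _
  simp only [e]
  have h : Tendsto (fun x : ℂ × ℂ =>
      ∑ τ ∈ (hS B).toFinset, evalAt x.2 (S.coeff τ) * pPow x.1 (τ - S.order)) (pToZero ×ˢ 𝓝 z₀)
      (𝓝 (∑ τ ∈ (hS B).toFinset, if S.order = τ then evalAt z₀ (S.coeff τ) else 0)) := by
    refine tendsto_finsetSum _ fun τ hτ => ?_
    have hτ' : τ ∈ S.support := ((hS B).mem_toFinset.1 hτ).1
    have h₁ := (tendsto_pPow (sub_nonneg.2 (HahnSeries.order_le_of_coeff_ne_zero hτ'))).comp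
      (tendsto_fst (f := pToZero) (g := 𝓝 z₀))
    have h₂ := (continuousAt_evalAt (hz₀ τ hτ')).tendsto.comp
      (tendsto_snd (f := pToZero) (g := 𝓝 z₀))
    refine (h₂.mul h₁).congr' ?_ |>.trans (le_of_eq ?_)
    · rfl
    · congr 1
      by_cases hτo : S.order = τ
      · simp [hτo]
      · simp [hτo, sub_eq_zero, Ne.symm hτo]
  refine h.trans (le_of_eq ?_)
  rw [Finset.sum_ite_eq, HahnSeries.leadingCoeff_eq]
  congr 1
  split_ifs with hmem
  · rfl
  -- This case is the zero series, whose leading coefficient is 0.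
  · have : S.coeff S.order = 0 := by
      by_contra hne
      exact hmem ((hS B).mem_toFinset.2 ⟨hne, hB⟩)
    simp [this, evalAt]

/-- Uniform convergence permits interchanging the limit of partial sums with p → 0. The exceptional
set is the zero set of P. -/
theorem IsSumInM.exists_finite_tendsto {S : HahnSeries ℝ (RatFunc ℂ)} {f : ℂ → ℂ → ℂ}
    (h : IsSumInM S f) : ∃ N : Set ℂ, N.Finite ∧ ∀ z₀ ∉ N,
      Tendsto (fun x : ℂ × ℂ => pPow x.1 (-S.order) * f x.1 x.2) (pToZero ×ˢ 𝓝 z₀)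
        (𝓝 (evalAt z₀ S.leadingCoeff)) := by
  obtain ⟨⟨hF, -⟩, P, hP, hden, hunif⟩ := h
  refine ⟨{z | P.eval z = 0}, ?_, fun z₀ hz₀ => ?_⟩
  · exact (P.roots.toFinset.finite_toSet).subset fun z hz => by
      simpa [hP, Polynomial.IsRoot] using hz
  have hopen : IsOpen {z : ℂ | P.eval z ≠ 0} := isOpen_ne_fun P.continuous continuous_const
  obtain ⟨r, hr, hrP⟩ := Metric.nhds_basis_closedBall.mem_iff.1 (hopen.mem_nhds hz₀)
  obtain ⟨ρ, hρ⟩ := hunif _ (isCompact_closedBall z₀ r) hrP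
  have hle : pToZero ×ˢ 𝓝 z₀ ≤ 𝓟 ({L : ℂ | L.re ≤ ρ} ×ˢ Metric.closedBall z₀ r) :=
    le_principal_iff.2 (prod_mem_prod (tendsto_re_pToZero.eventually (eventually_le_atBot ρ))
      (Metric.closedBall_mem_nhds z₀ hr))
  refine ((tendstoUniformlyOn_iff_tendstoUniformlyOnFilter.1 hρ).mono_right
    hle).tendsto_of_eventually_tendsto (L := fun _ => evalAt z₀ S.leadingCoeff) ?_
    tendsto_const_nhds
  filter_upwards [eventually_ge_atTop S.order] with B hB
  exact tendsto_partialSum hF (fun τ hτ => hden τ hτ z₀ hz₀) hB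

/-! ### The pole factor as `p → 0` -/

/-- The limit is 1 - y₀ for a = 0, 1 - y₀⁻¹ for a = 1, and 1 in between. -/
theorem exists_tendsto_theta {a : ℝ} (ha₀ : 0 ≤ a) (ha₁ : a ≤ 1) {y₀ : ℂ} (hy₀ : y₀ ≠ 0) :
    ∃ ℓ : ℂ, (y₀ ≠ 1 → ℓ ≠ 0) ∧
      Tendsto (fun x : ℂ × ℂ => theta (pPow x.1 a * x.2) (Complex.exp x.1)) (pToZero ×ˢ 𝓝 y₀)
        (𝓝 ℓ) := by
  have h₁ : Tendsto (fun x : ℂ × ℂ => x.2) (pToZero ×ˢ 𝓝 y₀) (𝓝 y₀) := tendsto_snd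
  have hp : Tendsto (fun x : ℂ × ℂ => Complex.exp x.1) (pToZero ×ˢ 𝓝 y₀) (𝓝 0) :=
    tendsto_exp_pToZero.comp tendsto_fst
  have h₂ := tendsto_qPoch (((tendsto_pPow ha₀).comp tendsto_fst).mul h₁) hp (by simp)
  have h₃ := tendsto_qPoch (((tendsto_pPow (sub_nonneg.2 ha₁)).comp tendsto_fst).mul
    (h₁.inv₀ hy₀)) hp (by simp)
  refine ⟨_, fun hy => ?_, (h₂.mul h₃).congr fun x => ?_⟩
  · have hy' : y₀⁻¹ ≠ 1 := fun e => hy (inv_eq_one.1 e)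
    simp only [qPoch_zero_right]
    refine mul_ne_zero ?_ ?_ <;> split_ifs <;>
      simp [sub_eq_zero, hy.symm, hy'.symm]
  · simp only [Function.comp, theta, pPow_one_sub]
    congr 2
    field_simp

theorem exists_tendsto_poleFactor {q t : ℂ} (hq₀ : q ≠ 0) (ht : t ≠ 0) {a : ℝ} (ha₀ : 0 ≤ a)
    (ha₁ : a ≤ 1) (m : ℕ) {z₀ : ℂ} (hz₀ : z₀ ≠ 0) :
    ∃ ℓ : ℂ, ((∀ r : ℕ, t / q ^ m * z₀ * q ^ r ≠ 1 ∧ t / q ^ m * z₀⁻¹ * q ^ r ≠ 1) → ℓ ≠ 0) ∧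
      Tendsto (fun x : ℂ × ℂ => poleFactor (t * pPow x.1 a) (Complex.exp x.1) q m x.2)
        (pToZero ×ˢ 𝓝 z₀) (𝓝 ℓ) := by
  have hqm : q ^ m ≠ 0 := pow_ne_zero _ hq₀
  have key : ∀ r : ℕ, ∀ y₀ : ℂ, y₀ ≠ 0 → ∃ ℓ : ℂ, (t / q ^ m * y₀ * q ^ r ≠ 1 → ℓ ≠ 0) ∧
      Tendsto (fun x : ℂ × ℂ => theta (t * pPow x.1 a / q ^ m * x.2 * q ^ r) (Complex.exp x.1))
        (pToZero ×ˢ 𝓝 y₀) (𝓝 ℓ) := fun r y₀ hy₀ => by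
    obtain ⟨ℓ, h₁, h₂⟩ := exists_tendsto_theta ha₀ ha₁ (y₀ := t / q ^ m * y₀ * q ^ r)
      (by positivity)
    have h₃ : Tendsto (fun x : ℂ × ℂ => (x.1, t / q ^ m * x.2 * q ^ r)) (pToZero ×ˢ 𝓝 y₀)
        (pToZero ×ˢ 𝓝 (t / q ^ m * y₀ * q ^ r)) :=
      tendsto_fst.prodMk ((tendsto_snd.const_mul _).mul_const _)
    refine ⟨ℓ, h₁, (h₂.comp h₃).congr fun x => ?_⟩
    · simp only [Function.comp]
      congr 1
      ring
  choose! ℓ hℓ₁ hℓ₂ using key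
  have hinv : Tendsto (fun x : ℂ × ℂ => (x.1, x.2⁻¹)) (pToZero ×ˢ 𝓝 z₀) (pToZero ×ˢ 𝓝 z₀⁻¹) :=
    tendsto_fst.prodMk (tendsto_snd.inv₀ hz₀)
  have hz₀' := inv_ne_zero hz₀
  refine ⟨(∏ r ∈ range m, ℓ r z₀) * ∏ r ∈ range m, ℓ r z₀⁻¹, fun h => mul_ne_zero
    (Finset.prod_ne_zero_iff.2 fun r _ => hℓ₁ r z₀ hz₀ (h r).1)
    (Finset.prod_ne_zero_iff.2 fun r _ => hℓ₁ r z₀⁻¹ hz₀' (h r).2), ?_⟩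
  refine ((tendsto_finsetProd _ fun r _ => hℓ₂ r z₀ hz₀).mul
    (tendsto_finsetProd _ fun r _ => (hℓ₂ r z₀⁻¹ hz₀').comp hinv)).congr' ?_
  filter_upwards [tendsto_snd.eventually (isOpen_ne.mem_nhds hz₀)] with x hx
  rw [poleFactor_eq (Complex.exp_ne_zero _) hq₀ hx (mul_ne_zero ht (pPow_ne_zero _ _))]
  rfl

theorem countable_poleFactor_limit_zeros (q t : ℂ) (m : ℕ) (hq₀ : q ≠ 0) :
    {z : ℂ | ∃ r : ℕ, t / q ^ m * z * q ^ r = 1 ∨ t / q ^ m * z⁻¹ * q ^ r = 1}.Countable := by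
  refine ((Set.countable_range fun r : ℕ => (t / q ^ m * q ^ r)⁻¹).union
    (Set.countable_range fun r : ℕ => t / q ^ m * q ^ r)).mono ?_
  rintro z ⟨r, h | h⟩
  · exact Or.inl ⟨r, (eq_inv_of_mul_eq_one_right (by rw [← h]; ring)).symm⟩
  · have hz : z ≠ 0 := fun e => by simp [e] at h
    refine Or.inr ⟨r, ?_⟩
    field_simp at h ⊢
    exact h

/-- The limits of `f` and of the pole factor exist, and the latter is not zero, away from a
countable set. -/
theorem MemTildeA.exists_countable_tendsto {q t : ℂ} {a : ℝ} {m : ℕ}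
    {S : HahnSeries ℝ (RatFunc ℂ)} {f : ℂ → ℂ → ℂ} (hf : MemTildeA q t a m S f) (hq₀ : q ≠ 0)
    (ht : t ≠ 0) (ha₀ : 0 ≤ a) (ha₁ : a ≤ 1) : ∃ N : Set ℂ, N.Countable ∧ ∀ z ∉ N,
      (∃ ℓ : ℂ, ℓ ≠ 0 ∧ Tendsto (fun x : ℂ × ℂ =>
        poleFactor (t * pPow x.1 a) (Complex.exp x.1) q m x.2) (pToZero ×ˢ 𝓝 z) (𝓝 ℓ)) ∧
      Tendsto (fun x : ℂ × ℂ => pPow x.1 (-S.order) * f x.1 x.2) (pToZero ×ˢ 𝓝 z)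
        (𝓝 (evalAt z S.leadingCoeff)) := by
  obtain ⟨N₁, hN₁, hf₁⟩ := hf.isSumInM.exists_finite_tendsto
  refine ⟨insert (0 : ℂ) (N₁ ∪
    {z : ℂ | ∃ r : ℕ, t / q ^ m * z * q ^ r = 1 ∨ t / q ^ m * z⁻¹ * q ^ r = 1}),
    (hN₁.countable.union (countable_poleFactor_limit_zeros q t m hq₀)).insert 0,
    fun z hz => ⟨?_, hf₁ z fun hz' => hz (Or.inr (Or.inl hz'))⟩⟩
  obtain ⟨ℓ, h₁, h₂⟩ := exists_tendsto_poleFactor hq₀ ht ha₀ ha₁ m (z₀ := z)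
    fun e => hz (Or.inl e)
  refine ⟨ℓ, h₁ fun r => ⟨fun e => ?_, fun e => ?_⟩, h₂⟩
  · exact hz (Or.inr (Or.inr ⟨r, Or.inl e⟩))
  · exact hz (Or.inr (Or.inr ⟨r, Or.inr e⟩))

/-- A countable set excludes only countably many radii. -/
theorem exists_sphere_disjoint {N : Set ℂ} (hN : N.Countable) (z₀ : ℂ) {R : ℝ} (hR : 0 < R) :
    ∃ r : ℝ, 0 < r ∧ r < R ∧ ∀ z ∈ Metric.sphere z₀ r, z ∉ N := by
  obtain ⟨r, hr, hrN⟩ : ∃ r ∈ Set.Ioo 0 R, r ∉ (fun z => ‖z - z₀‖) '' N := by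
    by_contra! hall
    exact (Cardinal.Real.Ioo_countable_iff.1 ((hN.image fun z => ‖z - z₀‖).mono hall)).not_gt hR
  exact ⟨r, hr.1, hr.2, fun z hz hzN => hrN ⟨z, hzN, mem_sphere_iff_norm.1 hz⟩⟩

/-- A bound for holomorphic functions on a sphere is a bound on the ball. -/
theorem isBigO_of_sphere {l : Filter ℂ} {Φ : ℂ → ℂ → ℂ} {z₀ : ℂ} {r : ℝ} (hr : 0 < r)
    (hd : ∀ᶠ L in l, DifferentiableOn ℂ (Φ L) (Metric.closedBall z₀ r)) {M : ℝ}
    (hM : ∀ᶠ L in l, ∀ z ∈ Metric.sphere z₀ r, ‖Φ L z‖ ≤ M) :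
    (fun x : ℂ × ℂ => Φ x.1 x.2) =O[l ×ˢ 𝓝 z₀] fun _ => (1 : ℝ) := by
  have hev : ∀ᶠ L in l, ∀ z ∈ Metric.closedBall z₀ r, ‖Φ L z‖ ≤ M := by
    filter_upwards [hM, hd] with L h₁ h₂ z hz
    rw [← closure_ball _ hr.ne'] at h₂ hz
    refine Complex.norm_le_of_forall_mem_frontier_norm_le Metric.isBounded_ball h₂.diffContOnCl
      (fun w hw => h₁ w ?_) hz
    rwa [frontier_ball _ hr.ne'] at hw
  refine Asymptotics.IsBigO.of_bound M ?_
  filter_upwards [hev.prod_mk (Metric.closedBall_mem_nhds z₀ hr)] with x hx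
  simpa using hx.1 x.2 hx.2

/-- The holomorphic function `poleFactor * f` and its behaviour as `p → 0`. -/
theorem MemTildeA.exists_holomorphic {q t : ℂ} {a : ℝ} {m : ℕ} {S : HahnSeries ℝ (RatFunc ℂ)}
    {f : ℂ → ℂ → ℂ} (hf : MemTildeA q t a m S f) (hq₀ : q ≠ 0) (ht : t ≠ 0) (ha₀ : 0 ≤ a)
    (ha₁ : a ≤ 1) : ∃ h : ℂ → ℂ → ℂ,
      (∀ᶠ L in pToZero, DifferentiableOn ℂ (h L) {0}ᶜ ∧ ∀ z : ℂ, z ≠ 0 →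
        poleFactor (t * pPow L a) (Complex.exp L) q m z ≠ 0 →
          poleFactor (t * pPow L a) (Complex.exp L) q m z * f L z = h L z) ∧
      ∀ z₀ : ℂ, z₀ ≠ 0 → (fun x : ℂ × ℂ => pPow x.1 (-S.order) * h x.1 x.2)
        =O[pToZero ×ˢ 𝓝 z₀] fun _ => (1 : ℝ) := by
  obtain ⟨N, hN, hfN⟩ := hf.exists_countable_tendsto hq₀ ht ha₀ ha₁
  have hex : ∀ L : ℂ, ∃ h : ℂ → ℂ, MemA (t * pPow L a) (Complex.exp L) q m (f L) →
      DifferentiableOn ℂ h {0}ᶜ ∧ ∀ z : ℂ, z ≠ 0 →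
        poleFactor (t * pPow L a) (Complex.exp L) q m z ≠ 0 →
          poleFactor (t * pPow L a) (Complex.exp L) q m z * f L z = h z := fun L => by
    by_cases hL : MemA (t * pPow L a) (Complex.exp L) q m (f L)
    · exact ⟨hL.holomorphic.choose, fun _ => hL.holomorphic.choose_spec⟩
    -- Only small p matter, so the choice for other L is arbitrary.
    · exact ⟨0, fun h => absurd h hL⟩
  choose h hh using hex
  have hh' := hf.memA.mono hh
  refine ⟨h, hh', fun z₀ hz₀ => ?_⟩
  -- On this circle both factors of h converge and the theta product stays away from 0. As r < ‖z₀‖,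
  -- the disc omits 0, so h is holomorphic on it and the bound extends inwards.
  obtain ⟨r, hr₀, hr₁, hrN⟩ := exists_sphere_disjoint hN z₀ (norm_pos_iff.2 hz₀)
  have hball : Metric.closedBall z₀ r ⊆ {0}ᶜ := fun z hz e => by
    rw [mem_closedBall_iff_norm, Set.mem_singleton_iff.1 e, zero_sub, norm_neg] at hz
    exact hz.not_gt hr₁
  have hsphere : IsCompact (Metric.sphere z₀ r) := isCompact_sphere z₀ r
  obtain ⟨M, hM⟩ := exists_bound_of_compact hsphere (l := pToZero) (Φ := fun L z =>
    poleFactor (t * pPow L a) (Complex.exp L) q m z * (pPow L (-S.order) * f L z)) fun z hz => by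
      obtain ⟨⟨ℓ, -, hlim⟩, hlim'⟩ := hfN z (hrN z hz)
      exact (hlim.mul hlim').isBigO_one ℝ
  have hne := eventually_forall_of_compact hsphere (l := pToZero)
    (P := fun x => poleFactor (t * pPow x.1 a) (Complex.exp x.1) q m x.2 ≠ 0) fun z hz => by
      obtain ⟨⟨ℓ, hℓ, hlim⟩, -⟩ := hfN z (hrN z hz)
      exact hlim.eventually (isOpen_ne.mem_nhds hℓ)
  refine isBigO_of_sphere (Φ := fun L z => pPow L (-S.order) * h L z) hr₀
    (hh'.mono fun L hL => (hL.1.mono hball).const_mul _) (M := M) ?_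
  filter_upwards [hM, hne, hh'] with L h₁ h₂ h₃ w hw
  rw [← h₃.2 w (hball (Metric.sphere_subset_closedBall hw)) (h₂ w hw), mul_left_comm]
  exact h₁ w hw

/-! ### Limits and comparison of contour integrals -/

theorem Loop.tendsto_integral (γ : Loop) {ι : Type*} {l : Filter ι} [l.IsCountablyGenerated]
    {Φ : ι → ℂ → ℂ} {F : ℂ → ℂ} {N : Set ℂ} (hN : N.Countable) {M : ℝ}
    (hc : ∀ᶠ i in l, ContinuousOn (Φ i) γ.image) (hb : ∀ᶠ i in l, ∀ z ∈ γ.image, ‖Φ i z‖ ≤ M)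
    (hl : ∀ z ∈ γ.image, z ∉ N → Tendsto (fun i => Φ i z) l (𝓝 (F z))) :
    Tendsto (fun i => γ.integral (Φ i)) l (𝓝 (γ.integral F)) := by
  have hmem : ∀ {s : ℝ}, s ∈ Set.uIoc (0 : ℝ) 1 → γ.toFun s ∈ γ.image := fun {s} hs => by
    rw [Set.uIoc_of_le zero_le_one] at hs
    exact Set.mem_image_of_mem _ (Set.Ioc_subset_Icc_self hs)
  refine intervalIntegral.tendsto_integral_filter_of_dominated_convergence
    (fun s => M * ‖derivWithin γ.toFun (Set.Icc 0 1) s‖) ?_ ?_ ?_ ?_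
  · filter_upwards [hc] with i hi
    exact (intervalIntegrable_iff.1 (γ.intervalIntegrable hi)).1
  · filter_upwards [hb] with i hi
    refine Eventually.of_forall fun s hs => ?_
    rw [norm_mul]
    exact mul_le_mul_of_nonneg_right (hi _ (hmem hs)) (norm_nonneg _)
  · refine ContinuousOn.intervalIntegrable ?_
    rw [Set.uIcc_of_le zero_le_one]
    exact continuousOn_const.mul γ.continuousOn_derivWithin.norm
  · filter_upwards [γ.ae_derivWithin_eq_zero hN] with s hs h₁
    by_cases h₂ : γ.toFun s ∈ N
    · simpa [hs h₁ h₂] using tendsto_const_nhds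
    · exact (hl _ (hmem h₁) h₂).mul_const _

theorem Cycle.tendsto_integral {C : Cycle} {ι : Type*} {l : Filter ι} [l.IsCountablyGenerated]
    {Φ : ι → ℂ → ℂ} {F : ℂ → ℂ} {N : Set ℂ} (hN : N.Countable) {M : ℝ}
    (hc : ∀ᶠ i in l, ContinuousOn (Φ i) C.trace) (hb : ∀ᶠ i in l, ∀ z ∈ C.trace, ‖Φ i z‖ ≤ M)
    (hl : ∀ z ∈ C.trace, z ∉ N → Tendsto (fun i => Φ i z) l (𝓝 (F z))) :
    Tendsto (fun i => C.integral (Φ i)) l (𝓝 (C.integral F)) := by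
  refine tendsto_finsetSum _ fun γ hγ => Tendsto.const_mul _ ?_
  have h := Cycle.image_subset_trace hγ
  exact γ.tendsto_integral hN (hc.mono fun i hi => hi.mono h)
    (hb.mono fun i hi z hz => hi z (h hz)) fun z hz => hl z (h hz)

theorem IsContour.trace_subset {W U : Set ℂ} {C : Cycle} (hC : IsContour W C)
    (hU : ∀ w ∉ U, w = 0 ∨ w ∈ W ∨ w⁻¹ ∈ W) : C.trace ⊆ U := by
  intro z hz
  by_contra hzU
  rcases hU z hzU with rfl | h | h
  · exact hC.zero_notMem hz
  · exact hC.notMem z h hz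
  · exact hC.inv_notMem _ h (by rwa [inv_inv])

/-- The difference of two contours winds around no point outside `U`, so Cauchy's theorem applies to
it. -/
theorem IsContour.integral_eq {W U : Set ℂ} {C D : Cycle} (hC : IsContour W C)
    (hD : IsContour W D) (hUo : IsOpen U) (hU : ∀ w ∉ U, w = 0 ∨ w ∈ W ∨ w⁻¹ ∈ W) {F : ℂ → ℂ}
    (hF : DifferentiableOn ℂ F U) : D.integral F = C.integral F := by
  rw [← sub_eq_zero, ← Cycle.integral_sub]
  refine Cycle.integral_eq_zero_of_winding_eq_zero hUo hF ((Cycle.trace_sub_subset _ _).trans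
    (Set.union_subset (hD.trace_subset hU) (hC.trace_subset hU))) fun w hw => ?_
  rw [Cycle.winding_sub]
  rcases hU w hw with rfl | h | h
  · rw [hC.winding_zero, hD.winding_zero, sub_self]
  · rw [hC.winding_eq_one w h, hD.winding_eq_one w h, sub_self]
  · have h₁ := hC.winding_inv_eq_zero _ h
    have h₂ := hD.winding_inv_eq_zero _ h
    rw [inv_inv] at h₁ h₂
    rw [h₁, h₂, sub_self]

/-! ### The domain of holomorphy of the elliptic weight -/

/-- The complement of the poles of `∏ Γ(T_r z^{±1};p,q)`. -/
noncomputable def regularSet (p q : ℂ) (T : Fin 6 → ℂ) : Set ℂ :=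
  {z | z ≠ 0 ∧ ∀ r, pqPoch (T r * z) p q ≠ 0 ∧ pqPoch (T r * z⁻¹) p q ≠ 0}

theorem isOpen_regularSet {p q : ℂ} (hp : ‖p‖ < 1) (hq : ‖q‖ < 1) (T : Fin 6 → ℂ) :
    IsOpen (regularSet p q T) := by
  have hc : Continuous fun x => pqPoch x p q := (differentiable_pqPoch hp hq).continuous
  rw [isOpen_iff_mem_nhds]
  rintro z ⟨hz, hr⟩
  refine Filter.Eventually.and (isOpen_ne.mem_nhds hz) ?_
  refine Filter.eventually_all.2 fun r => ?_
  have h₁ : ContinuousAt (fun z => pqPoch (T r * z) p q) z := by fun_prop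
  have h₂ : ContinuousAt (fun z => pqPoch (T r * z⁻¹) p q) z :=
    hc.continuousAt.comp (continuousAt_const.mul (continuousAt_inv₀ hz))
  exact (h₁.eventually_ne (hr r).1).and (h₂.eventually_ne (hr r).2)

theorem notMem_regularSet {p q : ℂ} (hp : ‖p‖ < 1) (hq : ‖q‖ < 1) {T : Fin 6 → ℂ} {w : ℂ}
    (hw : w ∉ regularSet p q T) :
    w = 0 ∨ w ∈ ellipticPoints p q T ∨ w⁻¹ ∈ ellipticPoints p q T := by
  by_contra! h
  refine hw ⟨h.1, fun r => ⟨fun e => h.2.2 ?_, fun e => h.2.1 ?_⟩⟩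
  · obtain ⟨i, j, hij⟩ := pqPoch_eq_zero hp hq e
    exact ⟨r, i, j, (eq_inv_of_mul_eq_one_left (by rw [← hij]; ring)).symm⟩
  · obtain ⟨i, j, hij⟩ := pqPoch_eq_zero hp hq e
    refine ⟨r, i, j, ?_⟩
    have := h.1
    field_simp at hij
    rw [← hij]
    ring

theorem differentiableAt_ellGamma {p q : ℂ} (hp : ‖p‖ < 1) (hq : ‖q‖ < 1) {x : ℂ} (hx : x ≠ 0)
    (h : pqPoch x p q ≠ 0) : DifferentiableAt ℂ (fun x => ellGamma x p q) x := by
  have hd : Differentiable ℂ fun x => pqPoch x p q := differentiable_pqPoch hp hq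
  exact DifferentiableAt.fun_div (hd.differentiableAt.comp x
    ((differentiableAt_const _).fun_div differentiableAt_id hx)) hd.differentiableAt h

/-- The holomorphic extension of `1/Γ(z^{±2};p,q)`. -/
noncomputable def invGammaSq (p q z : ℂ) : ℂ :=
  qPoch (z ^ 2) q * qPoch (p * z ^ 2) p * (qPoch (z⁻¹ ^ 2) q * qPoch (p * z⁻¹ ^ 2) p)

theorem differentiableAt_invGammaSq {p q : ℂ} (hp : ‖p‖ < 1) (hq : ‖q‖ < 1) {z : ℂ} (hz : z ≠ 0) :
    DifferentiableAt ℂ (invGammaSq p q) z := by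
  have h₁ : Differentiable ℂ fun x => qPoch x p := differentiable_qPoch hp
  have h₂ : Differentiable ℂ fun x => qPoch x q := differentiable_qPoch hq
  have h₃ : DifferentiableAt ℂ (fun z : ℂ => z⁻¹) z := differentiableAt_inv hz
  have h₄ : DifferentiableAt ℂ (fun z : ℂ => qPoch (z⁻¹ ^ 2) q) z :=
    h₂.differentiableAt.comp z (h₃.fun_pow 2)
  have h₅ : DifferentiableAt ℂ (fun z : ℂ => qPoch (p * z⁻¹ ^ 2) p) z :=
    h₁.differentiableAt.comp z ((h₃.fun_pow 2).const_mul p)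
  unfold invGammaSq
  fun_prop

/-- The elliptic weight, with `1/Γ(z^{±2};p,q)` replaced by its holomorphic extension. -/
noncomputable def weight (p q : ℂ) (T : Fin 6 → ℂ) (z : ℂ) : ℂ :=
  (∏ r : Fin 6, (ellGamma (T r * z) p q * ellGamma (T r * z⁻¹) p q)) * invGammaSq p q z *
    (1 / (2 * Real.pi * Complex.I * z))

theorem differentiableOn_weight {p q : ℂ} (hp : ‖p‖ < 1) (hq : ‖q‖ < 1) {T : Fin 6 → ℂ}
    (hT : ∀ r, T r ≠ 0) : DifferentiableOn ℂ (weight p q T) (regularSet p q T) := by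
  rintro z ⟨hz, hr⟩
  refine DifferentiableAt.differentiableWithinAt ?_
  refine ((DifferentiableAt.fun_finsetProd fun r _ => DifferentiableAt.fun_mul ?_ ?_).fun_mul
    (differentiableAt_invGammaSq hp hq hz)).fun_mul ?_
  · exact (differentiableAt_ellGamma hp hq (mul_ne_zero (hT r) hz) (hr r).1).comp z
      (differentiableAt_id.const_mul (T r))
  · exact (differentiableAt_ellGamma hp hq (mul_ne_zero (hT r) (inv_ne_zero hz)) (hr r).2).comp z
      ((differentiableAt_inv hz).const_mul (T r))
  · refine DifferentiableAt.fun_div (differentiableAt_const _) (by fun_prop) ?_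
    simp [hz, Real.pi_ne_zero]

/-! ### Exceptional sets -/

theorem countable_pqPoch_sq_zeros {p q : ℂ} (hp : ‖p‖ < 1) (hq : ‖q‖ < 1) (c : ℂ) :
    {z : ℂ | pqPoch (c * z ^ 2) p q = 0}.Countable := by
  have h : (⋃ n : ℕ × ℕ, {z : ℂ | z ^ 2 = (c * p ^ n.1 * q ^ n.2)⁻¹}).Countable := by
    refine Set.countable_iUnion fun n => Set.Finite.countable ?_
    refine (Polynomial.nthRoots 2 ((c * p ^ n.1 * q ^ n.2)⁻¹)).toFinset.finite_toSet.subset ?_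
    intro z hz
    simpa [Polynomial.mem_nthRoots] using hz
  refine h.mono fun z hz => ?_
  obtain ⟨i, j, hij⟩ := pqPoch_eq_zero hp hq hz
  exact Set.mem_iUnion.2 ⟨(i, j), (eq_inv_of_mul_eq_one_right (by rw [← hij]; ring))⟩

theorem countable_thetaPoch_zeros {p q : ℂ} (hp : ‖p‖ < 1) (c : ℂ) (m : ℕ) :
    {z : ℂ | thetaPoch (c * z) q p m = 0}.Countable := by
  refine ((Set.countable_range fun n : ℕ × ℕ => (c * q ^ n.1 * p ^ n.2)⁻¹).union
    (Set.countable_range fun n : ℕ × ℕ => p * p ^ n.2 / (c * q ^ n.1))).mono fun z hz => ?_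
  obtain ⟨r, -, hr⟩ := Finset.prod_eq_zero_iff.1 (show thetaPoch (c * z) q p m = 0 from hz)
  rcases mul_eq_zero.1 hr with h | h
  · obtain ⟨i, hi⟩ := qPoch_eq_zero hp h
    exact Or.inl ⟨(r, i), (eq_inv_of_mul_eq_one_right (by rw [← hi]; ring)).symm⟩
  · obtain ⟨i, hi⟩ := qPoch_eq_zero hp h
    refine Or.inr ⟨(r, i), ?_⟩
    have hne : c * z * q ^ r ≠ 0 := fun e => by simp [e] at hi
    have h₁ := left_ne_zero_of_mul hne
    have hc := left_ne_zero_of_mul h₁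
    have hz := right_ne_zero_of_mul h₁
    have hqr := right_ne_zero_of_mul hne
    field_simp at hi ⊢
    exact hi

theorem countable_poleFactor_zeros {p : ℂ} (hp : ‖p‖ < 1) (u q : ℂ) (m : ℕ) :
    {z : ℂ | poleFactor u p q m z = 0}.Countable := by
  have h := countable_thetaPoch_zeros (q := q) hp (p * q / u) m
  refine (h.union (h.preimage inv_injective)).mono fun z hz => ?_
  rcases mul_eq_zero.1 (show poleFactor u p q m z = 0 from hz) with h₁ | h₁
  · refine Or.inl ?_
    rw [← h₁, Set.mem_ofPred_eq, mul_div_right_comm (p * q)]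
  · refine Or.inr ?_
    rw [← h₁, Set.mem_preimage, Set.mem_ofPred_eq, mul_div_right_comm (p * q)]

/-! ### The limit of elliptic gamma functions -/

/-- The numerator has argument q p^{1-σ}/(ty) and the denominator t p^σ y. The first survives the
limit only for σ = 1, the second only for σ = 0. -/
theorem tendsto_ellGamma {q t y₀ : ℂ} (hq : ‖q‖ < 1) (hy₀ : y₀ ≠ 0) {σ : ℝ}
    (hσ₀ : 0 ≤ σ) (hσ₁ : σ ≤ 1) (hne : σ = 0 → qPoch (t * y₀) q ≠ 0) :
    Tendsto (fun x : ℂ × ℂ => ellGamma (t * pPow x.1 σ * x.2) (Complex.exp x.1) q)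
      (pToZero ×ˢ 𝓝 y₀) (𝓝 ((if σ = 1 then qPoch (q * t⁻¹ * y₀⁻¹) q else 1) /
        if σ = 0 then qPoch (t * y₀) q else 1)) := by
  have h₁ : Tendsto (fun x : ℂ × ℂ => x.2) (pToZero ×ˢ 𝓝 y₀) (𝓝 y₀) := tendsto_snd
  have hp : Tendsto (fun x : ℂ × ℂ => Complex.exp x.1) (pToZero ×ˢ 𝓝 y₀) (𝓝 0) :=
    tendsto_exp_pToZero.comp tendsto_fst
  have h₂ := tendsto_pqPoch ((((tendsto_pPow hσ₀).comp tendsto_fst).const_mul t).mul h₁) hp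
    (by simp) hq
  have h₃ := tendsto_pqPoch ((((tendsto_pPow (sub_nonneg.2 hσ₁)).comp tendsto_fst).const_mul
    (q * t⁻¹)).mul (h₁.inv₀ hy₀)) hp (by simp) hq
  have e₂ : pqPoch ((t * if σ = 0 then 1 else 0) * y₀) 0 q =
      if σ = 0 then qPoch (t * y₀) q else 1 := by
    split_ifs <;> simp [pqPoch_zero]
  have e₃ : pqPoch ((q * t⁻¹ * if 1 - σ = 0 then 1 else 0) * y₀⁻¹) 0 q =
      if σ = 1 then qPoch (q * t⁻¹ * y₀⁻¹) q else 1 := by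
    simp only [sub_eq_zero, eq_comm (a := (1 : ℝ))]
    split_ifs <;> simp [pqPoch_zero]
  rw [e₂] at h₂
  rw [e₃] at h₃
  refine (h₃.div h₂ ?_).congr fun x => ?_
  · split_ifs with h
    · exact hne h
    · exact one_ne_zero
  · simp only [Pi.div_apply, Function.comp, ellGamma, pPow_one_sub]
    congr 2
    simp only [div_eq_mul_inv, mul_inv]
    ring

theorem tendsto_invGammaSq {q z₀ : ℂ} (hq : ‖q‖ < 1) (hz₀ : z₀ ≠ 0) :
    Tendsto (fun x : ℂ × ℂ => invGammaSq (Complex.exp x.1) q x.2) (pToZero ×ˢ 𝓝 z₀)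
      (𝓝 (qPoch (z₀ ^ 2) q * qPoch (z₀⁻¹ ^ 2) q)) := by
  have h₁ : Tendsto (fun x : ℂ × ℂ => x.2) (pToZero ×ˢ 𝓝 z₀) (𝓝 z₀) := tendsto_snd
  have hp : Tendsto (fun x : ℂ × ℂ => Complex.exp x.1) (pToZero ×ˢ 𝓝 z₀) (𝓝 0) :=
    tendsto_exp_pToZero.comp tendsto_fst
  have key : ∀ {y : ℂ × ℂ → ℂ} {y₀ : ℂ}, Tendsto y (pToZero ×ˢ 𝓝 z₀) (𝓝 y₀) →
      Tendsto (fun x => qPoch (y x) q * qPoch (Complex.exp x.1 * y x) (Complex.exp x.1))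
        (pToZero ×ˢ 𝓝 z₀) (𝓝 (qPoch y₀ q)) := fun hy => by
    simpa using (tendsto_qPoch hy tendsto_const_nhds hq).mul (tendsto_qPoch (hp.mul hy) hp (by simp))
  exact (key (h₁.pow 2)).mul (key ((h₁.inv₀ hz₀).pow 2))

theorem tendsto_ellGamma_mul_ellGamma {q t z₀ : ℂ} (hq : ‖q‖ < 1) (hz₀ : z₀ ≠ 0) {σ : ℝ}
    (hσ₀ : 0 ≤ σ) (hσ₁ : σ ≤ 1) (h₁ : σ = 0 → qPoch (t * z₀) q ≠ 0)
    (h₂ : σ = 0 → qPoch (t * z₀⁻¹) q ≠ 0) :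
    Tendsto (fun x : ℂ × ℂ => ellGamma (t * pPow x.1 σ * x.2) (Complex.exp x.1) q *
        ellGamma (t * pPow x.1 σ * x.2⁻¹) (Complex.exp x.1) q) (pToZero ×ˢ 𝓝 z₀)
      (𝓝 ((if σ = 1 then qPoch (q * t⁻¹ * z₀) q * qPoch (q * t⁻¹ * z₀⁻¹) q else 1) /
        if σ = 0 then qPoch (t * z₀) q * qPoch (t * z₀⁻¹) q else 1)) := by
  have hinv : Tendsto (fun x : ℂ × ℂ => (x.1, x.2⁻¹)) (pToZero ×ˢ 𝓝 z₀) (pToZero ×ˢ 𝓝 z₀⁻¹) :=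
    tendsto_fst.prodMk (tendsto_snd.inv₀ hz₀)
  refine ((tendsto_ellGamma hq hz₀ hσ₀ hσ₁ h₁).mul ((tendsto_ellGamma hq (inv_ne_zero hz₀) hσ₀ hσ₁
    h₂).comp hinv)).trans (le_of_eq ?_)
  congr 1
  rw [inv_inv, div_mul_div_comm]
  split_ifs <;> simp [mul_comm (qPoch (q * t⁻¹ * z₀⁻¹) q)]

theorem tendsto_prod_ellGamma {q z₀ : ℂ} {t : Fin 6 → ℂ} {α : Fin 6 → ℝ} (hq : ‖q‖ < 1)
    (hz₀ : z₀ ≠ 0) (hα₀ : ∀ r, 0 ≤ α r) (hα₁ : ∀ r, α r ≤ 1)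
    (hne : ∀ r, α r = 0 → qPoch (t r * z₀) q ≠ 0 ∧ qPoch (t r * z₀⁻¹) q ≠ 0) :
    Tendsto (fun x : ℂ × ℂ => ∏ r : Fin 6,
        (ellGamma (t r * pPow x.1 (α r) * x.2) (Complex.exp x.1) q *
          ellGamma (t r * pPow x.1 (α r) * x.2⁻¹) (Complex.exp x.1) q)) (pToZero ×ˢ 𝓝 z₀)
      (𝓝 ((∏ r : Fin 6 with α r = 1,
          (qPoch (q * (t r)⁻¹ * z₀) q * qPoch (q * (t r)⁻¹ * z₀⁻¹) q)) /
        ∏ r : Fin 6 with α r = 0, (qPoch (t r * z₀) q * qPoch (t r * z₀⁻¹) q))) := by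
  rw [Finset.prod_filter, Finset.prod_filter, ← Finset.prod_div_distrib]
  exact tendsto_finsetProd _ fun r _ => tendsto_ellGamma_mul_ellGamma hq hz₀ (hα₀ r) (hα₁ r)
    (fun h => (hne r h).1) fun h => (hne r h).2

/-! ### Contours of the two bilinear forms -/

theorem exists_isContour_limitPoints {q : ℂ} (hq₀ : q ≠ 0) (hq₁ : ‖q‖ < 1) {α : Fin 6 → ℝ}
    {T : Fin 6 → ℂ} (hT : ∀ r, T r ≠ 0)
    (hgen : ∀ r s, α r = 0 → α s = 0 → ∀ j : ℕ, q ^ j * (T r * T s) ≠ 1) :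
    ∃ C : Cycle, IsContour (limitPoints q α T) C := by
  refine exists_isContour ?_ (fun ε hε => ?_) ?_
  · rintro ⟨r, j, -, h⟩
    exact mul_ne_zero (pow_ne_zero j hq₀) (hT r) h.symm
  · have hfin : ∀ r : Fin 6, {j : ℕ | ε ≤ ‖q ^ j * T r‖}.Finite := fun r => by
      have h : Tendsto (fun j : ℕ => ‖q ^ j * T r‖) atTop (𝓝 0) := by
        simpa using ((tendsto_pow_atTop_nhds_zero_of_norm_lt_one hq₁).mul_const (T r)).norm
      have h' := h.eventually (gt_mem_nhds hε)
      rw [← Nat.cofinite_eq_atTop, Filter.eventually_cofinite] at h'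
      simpa using h'
    refine (Set.finite_iUnion fun r => (hfin r).image fun j => q ^ j * T r).subset ?_
    rintro w ⟨⟨r, j, -, rfl⟩, hw⟩
    exact Set.mem_iUnion.2 ⟨r, j, hw, rfl⟩
  · rintro _ ⟨r, j, hr, rfl⟩ _ ⟨s, k, hs, rfl⟩ h
    exact hgen r s hr hs (j + k) (by rw [← h]; ring)

/-- A point with α_r = 0 and i = 0 is a limit point; any other is bounded by ‖p t̃_r‖ or ‖t̃_r
p^{α_r}‖, both of which tend to 0. -/
theorem IsContour.eventually_ellipticPoints {q : ℂ} (hq₀ : q ≠ 0) (hq₁ : ‖q‖ < 1)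
    {α : Fin 6 → ℝ} (hα : ∀ r, 0 ≤ α r) {T : Fin 6 → ℂ} (hT : ∀ r, T r ≠ 0) {C : Cycle}
    (hC : IsContour (limitPoints q α T) C) :
    ∀ᶠ L in pToZero, IsContour (ellipticPoints (Complex.exp L) q fun r => T r * pPow L (α r)) C := by
  obtain ⟨ε, hε, h⟩ := hC.exists_forall_norm_lt
  have h₁ : ∀ r, ∀ᶠ L in pToZero, ‖Complex.exp L * T r‖ < ε := fun r => by
    have := (tendsto_exp_pToZero.mul_const (T r)).norm
    simp only [zero_mul, norm_zero] at this
    exact this.eventually (gt_mem_nhds hε)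
  have h₂ : ∀ r, ∀ᶠ L in pToZero, α r ≠ 0 → ‖T r * pPow L (α r)‖ < ε := fun r => by
    by_cases hr : α r = 0
    · simp [hr]
    · have := ((tendsto_pPow (hα r)).const_mul (T r)).norm
      simp only [hr, if_false, mul_zero, norm_zero] at this
      exact (this.eventually (gt_mem_nhds hε)).mono fun L hL _ => hL
  filter_upwards [eventually_all.2 h₁, eventually_all.2 h₂, eventually_norm_exp_lt_one]
    with L h₁ h₂ hp
  refine h _ ?_
  rintro _ ⟨r, i, j, rfl⟩
  refine ⟨mul_ne_zero (mul_ne_zero (pow_ne_zero _ (Complex.exp_ne_zero _)) (pow_ne_zero _ hq₀))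
    (mul_ne_zero (hT r) (pPow_ne_zero _ _)), ?_⟩
  have hle : ∀ i : ℕ, ‖Complex.exp L ^ i * q ^ j‖ ≤ 1 := fun i => by
    rw [norm_mul, norm_pow, norm_pow]
    exact mul_le_one₀ (pow_le_one₀ (norm_nonneg _) hp.le) (by positivity)
      (pow_le_one₀ (norm_nonneg _) hq₁.le)
  by_cases hr : α r = 0
  · rcases i with _ | i
    · exact Or.inl ⟨r, j, hr, by simp [hr]⟩
    · refine Or.inr ?_
      beta_reduce
      rw [hr, pPow_zero, show Complex.exp L ^ (i + 1) * q ^ j * (T r * 1) =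
        Complex.exp L ^ i * q ^ j * (Complex.exp L * T r) by ring, norm_mul]
      exact (mul_le_of_le_one_left (norm_nonneg _) (hle i)).trans_lt (h₁ r)
  · refine Or.inr ?_
    rw [norm_mul]
    exact (mul_le_of_le_one_left (norm_nonneg _) (hle i)).trans_lt (h₂ r hr)

/-- A zero would force z or z⁻¹ to be a point q^{k+j} t̃_r. The shift k serves to treat t_r = t̃_r
q^k along with t̃_r. -/
theorem ne_zero_of_mem_trace {q : ℂ} (hq₁ : ‖q‖ < 1) {α : Fin 6 → ℝ} {T : Fin 6 → ℂ} {C : Cycle}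
    (hC : IsContour (limitPoints q α T) C) {z : ℂ} (hz : z ∈ C.trace) {r : Fin 6} (hr : α r = 0)
    (k : ℕ) : qPoch (T r * q ^ k * z) q ≠ 0 ∧ qPoch (T r * q ^ k * z⁻¹) q ≠ 0 := by
  have hz₀ : z ≠ 0 := fun e => hC.zero_notMem (e ▸ hz)
  constructor <;> refine qPoch_ne_zero hq₁ fun j e => ?_
  · refine hC.inv_notMem (q ^ (k + j) * T r) ⟨r, k + j, hr, rfl⟩ ?_
    rwa [← eq_inv_of_mul_eq_one_left (a := z) (by rw [← e]; ring)]
  · refine hC.notMem (q ^ (k + j) * T r) ⟨r, k + j, hr, rfl⟩ ?_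
    convert hz using 1
    field_simp at e
    rw [← e]
    ring

/-! ### The prefactors -/

theorem tendsto_prefactor {q : ℂ} (hq₁ : ‖q‖ < 1) {t : Fin 6 → ℂ} (ht : ∀ r, t r ≠ 0)
    {α : Fin 6 → ℝ} (hα₀ : ∀ r, 0 ≤ α r) (hα₁ : ∀ r s, r ≠ s → α r + α s ≤ 1)
    (h₀ : ∀ r s, r ≠ s → α r + α s = 0 → qPoch (t r * t s) q ≠ 0)
    (h₁ : ∀ r s, r ≠ s → α r + α s = 1 → ∀ j : ℕ, t r * t s ≠ q ^ (j + 1)) :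
    Tendsto (fun L => qPoch q q * qPoch (Complex.exp L) (Complex.exp L) /
        (2 * ∏ r : Fin 6, ∏ s ∈ Finset.Ioi r,
          ellGamma (t r * pPow L (α r) * (t s * pPow L (α s))) (Complex.exp L) q)) pToZero
      (𝓝 ((qPoch q q * ∏ r : Fin 6, ∏ s ∈ Finset.Ioi r with α r + α s = 0,
          qPoch (t r * t s) q) /
        (2 * ∏ r : Fin 6, ∏ s ∈ Finset.Ioi r with α r + α s = 1,
          qPoch (q * (t r)⁻¹ * (t s)⁻¹) q))) := by
  set A : Fin 6 → Fin 6 → ℂ := fun r s =>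
    if α r + α s = 1 then qPoch (q * (t r)⁻¹ * (t s)⁻¹) q else 1 with hA
  set B : Fin 6 → Fin 6 → ℂ := fun r s => if α r + α s = 0 then qPoch (t r * t s) q else 1 with hB
  -- The gamma factors of the prefactor carry no z, so their limit is the one of `tendsto_ellGamma`
  -- along the constant y = 1.
  have hpt : Tendsto (fun L : ℂ => (L, (1 : ℂ))) pToZero (pToZero ×ˢ 𝓝 1) :=
    tendsto_id.prodMk tendsto_const_nhds
  have hlim : ∀ r s, r ≠ s → Tendsto (fun L =>
      ellGamma (t r * pPow L (α r) * (t s * pPow L (α s))) (Complex.exp L) q) pToZero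
      (𝓝 (A r s / B r s)) := fun r s hrs => by
    have h := (tendsto_ellGamma (t := t r * t s) hq₁ one_ne_zero (add_nonneg (hα₀ r) (hα₀ s))
      (hα₁ r s hrs) fun h => by simpa using h₀ r s hrs h).comp hpt
    refine (h.congr fun L => ?_).trans (le_of_eq ?_)
    · simp only [Function.comp, mul_one, pPow_add]
      congr 1
      ring
    · simp only [hA, hB, inv_one, mul_one, mul_inv, mul_assoc]
  have hAne : ∀ r s, r ≠ s → A r s ≠ 0 := fun r s hrs => by
    simp only [hA]
    split_ifs with h
    · refine qPoch_ne_zero hq₁ fun j e => h₁ r s hrs h j ?_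
      have := ht r
      have := ht s
      field_simp at e
      rw [← e]
      ring
    · exact one_ne_zero
  have hBne : ∀ r s, r ≠ s → B r s ≠ 0 := fun r s hrs => by
    simp only [hB]
    split_ifs with h
    · exact h₀ r s hrs h
    · exact one_ne_zero
  have hne : ∀ r s : Fin 6, s ∈ Finset.Ioi r → r ≠ s := fun r s h => (Finset.mem_Ioi.1 h).ne
  have hprod := tendsto_finsetProd (Finset.univ : Finset (Fin 6)) fun r _ =>
    tendsto_finsetProd (Finset.Ioi r) fun s hs => hlim r s (hne r s hs)
  have hnum := (tendsto_qPoch tendsto_exp_pToZero tendsto_exp_pToZero (by simp)).const_mul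
    (qPoch q q)
  refine (hnum.div (hprod.const_mul 2) ?_).trans (le_of_eq ?_)
  · refine mul_ne_zero two_ne_zero (Finset.prod_ne_zero_iff.2 fun r _ =>
      Finset.prod_ne_zero_iff.2 fun s hs => ?_)
    exact div_ne_zero (hAne r s (hne r s hs)) (hBne r s (hne r s hs))
  · congr 1
    simp only [Finset.prod_filter, Finset.prod_div_distrib, qPoch_zero_left, mul_one]
    rw [mul_div_assoc', div_div_eq_mul_div]

/-! ### The integrand -/

theorem tilde_ne_zero {q : ℂ} (hq₀ : q ≠ 0) {t : Fin 6 → ℂ} (ht : ∀ r, t r ≠ 0) (mf mg : ℕ)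
    (r : Fin 6) : tilde q mf mg t r ≠ 0 := div_ne_zero (ht r) (pow_ne_zero _ hq₀)

theorem tilde_mul_pow {q : ℂ} (hq₀ : q ≠ 0) (t : Fin 6 → ℂ) (mf mg : ℕ) (r : Fin 6) :
    tilde q mf mg t r * q ^ (![0, 0, 0, 0, mf, mg] r) = t r :=
  div_mul_cancel₀ _ (pow_ne_zero _ hq₀)

theorem tilde_mul (q : ℂ) (t u : Fin 6 → ℂ) (mf mg : ℕ) (r : Fin 6) :
    tilde q mf mg t r * u r = tilde q mf mg (fun r => t r * u r) r :=
  div_mul_eq_mul_div _ _ _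

theorem prod_ellGamma_eq {p q : ℂ} (hp : ‖p‖ < 1) (hp₀ : p ≠ 0) (hq₁ : ‖q‖ < 1) (hq₀ : q ≠ 0)
    {u : Fin 6 → ℂ} (hu : ∀ r, u r ≠ 0) {mf mg : ℕ} {z : ℂ} (hz : z ≠ 0)
    (hf : poleFactor (u 4) p q mf z ≠ 0) (hg : poleFactor (u 5) p q mg z ≠ 0) :
    ∏ r : Fin 6, (ellGamma (u r * z) p q * ellGamma (u r * z⁻¹) p q) =
      poleFactor (u 4) p q mf z * poleFactor (u 5) p q mg z *
        ∏ r : Fin 6, (ellGamma (tilde q mf mg u r * z) p q *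
          ellGamma (tilde q mf mg u r * z⁻¹) p q) := by
  rw [Fin.prod_univ_six, Fin.prod_univ_six, poleFactor_mul_ellGamma hp hp₀ hq₁ hq₀ hz (hu 4) hf,
    poleFactor_mul_ellGamma hp hp₀ hq₁ hq₀ hz (hu 5) hg]
  have e₀ : tilde q mf mg u 0 = u 0 := by simp [tilde]
  have e₁ : tilde q mf mg u 1 = u 1 := by simp [tilde]
  have e₂ : tilde q mf mg u 2 = u 2 := by simp [tilde]
  have e₃ : tilde q mf mg u 3 = u 3 := by simp [tilde]
  have e₄ : tilde q mf mg u 4 = u 4 / q ^ mf := by simp [tilde]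
  have e₅ : tilde q mf mg u 5 = u 5 / q ^ mg := by simp [tilde]
  rw [e₀, e₁, e₂, e₃, e₄, e₅]
  ring

theorem div_ellGamma_sq {p q z : ℂ} (hp : ‖p‖ < 1) (hq : ‖q‖ < 1)
    (h₁ : pqPoch (p * q * z ^ 2) p q ≠ 0) (h₂ : pqPoch (p * q * z⁻¹ ^ 2) p q ≠ 0) (X : ℂ) :
    X / (ellGamma (z ^ 2) p q * ellGamma (z⁻¹ ^ 2) p q) = X * invGammaSq p q z := by
  rw [inv_pow] at h₂ ⊢
  rw [div_eq_mul_inv, inv_ellGamma_mul_inv_ellGamma hp hq h₁ h₂, invGammaSq, inv_pow]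

/-- The integrals of the elliptic integrand over a contour agree with those of its holomorphic
extension over any other contour. -/
theorem integral_elliptic_eq {p q : ℂ} (hp : ‖p‖ < 1) (hp₀ : p ≠ 0) (hq₁ : ‖q‖ < 1) (hq₀ : q ≠ 0)
    {u : Fin 6 → ℂ} (hu : ∀ r, u r ≠ 0) {mf mg : ℕ} {f g hf hg : ℂ → ℂ}
    (hfd : DifferentiableOn ℂ hf {0}ᶜ) (hgd : DifferentiableOn ℂ hg {0}ᶜ)
    (hfe : ∀ z, z ≠ 0 → poleFactor (u 4) p q mf z ≠ 0 → poleFactor (u 4) p q mf z * f z = hf z)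
    (hge : ∀ z, z ≠ 0 → poleFactor (u 5) p q mg z ≠ 0 → poleFactor (u 5) p q mg z * g z = hg z)
    {C D : Cycle} (hC : IsContour (ellipticPoints p q (tilde q mf mg u)) C)
    (hD : IsContour (ellipticPoints p q (tilde q mf mg u)) D) :
    (D.integral fun z => f z * g z *
        ((∏ r : Fin 6, (ellGamma (u r * z) p q * ellGamma (u r * z⁻¹) p q)) /
          (ellGamma (z ^ 2) p q * ellGamma (z⁻¹ ^ 2) p q)) *
        (1 / (2 * Real.pi * Complex.I * z))) =
      C.integral fun z => hf z * hg z * weight p q (tilde q mf mg u) z := by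
  have hT := tilde_ne_zero hq₀ hu mf mg
  have hsub : regularSet p q (tilde q mf mg u) ⊆ {0}ᶜ := fun z hz => hz.1
  have hN := (((countable_poleFactor_zeros hp (u 4) q mf).union
    (countable_poleFactor_zeros hp (u 5) q mg)).union
    ((countable_pqPoch_sq_zeros hp hq₁ (p * q)).union
      ((countable_pqPoch_sq_zeros hp hq₁ (p * q)).preimage inv_injective)))
  -- After passing from `C` to `D`, both integrands live on the same cycle. They can differ only on
  -- a countable set, where f or g is unspecified or a gamma quotient degenerates.
  rw [← hC.integral_eq hD (isOpen_regularSet hp hq₁ _) (fun w => notMem_regularSet hp hq₁)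
    (((hfd.mono hsub).fun_mul (hgd.mono hsub)).fun_mul (differentiableOn_weight hp hq₁ hT))]
  refine Cycle.integral_congr hN fun z hzD hzN => ?_
  have hz : z ≠ 0 := fun e => hD.zero_notMem (e ▸ hzD)
  have h₁ : poleFactor (u 4) p q mf z ≠ 0 := fun e => hzN (Or.inl (Or.inl e))
  have h₂ : poleFactor (u 5) p q mg z ≠ 0 := fun e => hzN (Or.inl (Or.inr e))
  rw [div_ellGamma_sq hp hq₁ (fun e => hzN (Or.inr (Or.inl e)))
    (fun e => hzN (Or.inr (Or.inr e))), prod_ellGamma_eq hp hp₀ hq₁ hq₀ hu hz h₁ h₂,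
    ← hfe z hz h₁, ← hge z hz h₂, weight]
  ring

theorem tendsto_kernel {z₀ : ℂ} (hz₀ : z₀ ≠ 0) :
    Tendsto (fun x : ℂ × ℂ => 1 / (2 * Real.pi * Complex.I * x.2)) (pToZero ×ˢ 𝓝 z₀)
      (𝓝 (1 / (2 * Real.pi * Complex.I * z₀))) :=
  tendsto_const_nhds.div (tendsto_snd.const_mul _) (by simp [hz₀, Real.pi_ne_zero])

/-- The limit of the integrals over a fixed contour. -/
theorem tendsto_integral_weight {q : ℂ} (hq₀ : q ≠ 0) (hq₁ : ‖q‖ < 1) {t : Fin 6 → ℂ}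
    (ht : ∀ r, t r ≠ 0) {α : Fin 6 → ℝ} (hα₀ : ∀ r, 0 ≤ α r) (hα₁ : ∀ r, α r ≤ 1) {mf mg : ℕ}
    {Sf Sg : HahnSeries ℝ (RatFunc ℂ)} {f g hf hg : ℂ → ℂ → ℂ}
    (hfA : MemTildeA q (t 4) (α 4) mf Sf f) (hgA : MemTildeA q (t 5) (α 5) mg Sg g)
    (hfe : ∀ᶠ L in pToZero, DifferentiableOn ℂ (hf L) {0}ᶜ ∧ ∀ z : ℂ, z ≠ 0 →
      poleFactor (t 4 * pPow L (α 4)) (Complex.exp L) q mf z ≠ 0 →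
        poleFactor (t 4 * pPow L (α 4)) (Complex.exp L) q mf z * f L z = hf L z)
    (hge : ∀ᶠ L in pToZero, DifferentiableOn ℂ (hg L) {0}ᶜ ∧ ∀ z : ℂ, z ≠ 0 →
      poleFactor (t 5 * pPow L (α 5)) (Complex.exp L) q mg z ≠ 0 →
        poleFactor (t 5 * pPow L (α 5)) (Complex.exp L) q mg z * g L z = hg L z)
    (hfO : ∀ z₀ : ℂ, z₀ ≠ 0 → (fun x : ℂ × ℂ => pPow x.1 (-Sf.order) * hf x.1 x.2)
      =O[pToZero ×ˢ 𝓝 z₀] fun _ => (1 : ℝ))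
    (hgO : ∀ z₀ : ℂ, z₀ ≠ 0 → (fun x : ℂ × ℂ => pPow x.1 (-Sg.order) * hg x.1 x.2)
      =O[pToZero ×ˢ 𝓝 z₀] fun _ => (1 : ℝ))
    {C : Cycle} (hC : IsContour (limitPoints q α (tilde q mf mg t)) C) :
    Tendsto (fun L => C.integral fun z =>
        pPow L (-Sf.order) * hf L z * (pPow L (-Sg.order) * hg L z) *
          weight (Complex.exp L) q (tilde q mf mg fun r => t r * pPow L (α r)) z) pToZero
      (𝓝 (C.integral fun z => evalAt z Sf.leadingCoeff * evalAt z Sg.leadingCoeff *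
        ((qPoch (z ^ 2) q * qPoch (z⁻¹ ^ 2) q *
            ∏ r : Fin 6 with α r = 1,
              (qPoch (q * (t r)⁻¹ * z) q * qPoch (q * (t r)⁻¹ * z⁻¹) q)) /
          ∏ r : Fin 6 with α r = 0, (qPoch (t r * z) q * qPoch (t r * z⁻¹) q)) *
        (1 / (2 * Real.pi * Complex.I * z)))) := by
  have hT := tilde_ne_zero hq₀ ht mf mg
  have hz₀ : ∀ z ∈ C.trace, z ≠ 0 := fun z hz e => hC.zero_notMem (e ▸ hz)
  obtain ⟨Nf, hNf, hf₁⟩ := hfA.exists_countable_tendsto hq₀ (ht 4) (hα₀ 4) (hα₁ 4)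
  obtain ⟨Ng, hNg, hg₁⟩ := hgA.exists_countable_tendsto hq₀ (ht 5) (hα₀ 5) (hα₁ 5)
  -- The bound uses the form with h_f, h_g and the parameters t̃_r: each factor is locally bounded
  -- at every point of `C`, exceptional ones included.
  obtain ⟨M, hM⟩ := exists_bound_of_compact C.isCompact_trace (l := pToZero) (Φ := fun L z =>
      pPow L (-Sf.order) * hf L z * (pPow L (-Sg.order) * hg L z) *
        weight (Complex.exp L) q (tilde q mf mg fun r => t r * pPow L (α r)) z) fun z hz => by
    have h₁ := (((tendsto_prod_ellGamma hq₁ (hz₀ z hz) hα₀ hα₁ fun r hr => by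
      simpa using ne_zero_of_mem_trace hq₁ hC hz hr 0).mul (tendsto_invGammaSq hq₁ (hz₀ z hz))).mul
      (tendsto_kernel (hz₀ z hz))).isBigO_one ℝ
    have h₂ := ((hfO z (hz₀ z hz)).mul (hgO z (hz₀ z hz))).mul h₁
    simp only [mul_one] at h₂
    refine h₂.congr_left fun x => ?_
    simp only [weight, tilde_mul q t (fun r => pPow x.1 (α r))]
  refine Cycle.tendsto_integral (hNf.union hNg) (M := M) ?_ hM fun z hz hzN => ?_
  · filter_upwards [hfe, hge, eventually_norm_exp_lt_one,
      hC.eventually_ellipticPoints hq₀ hq₁ hα₀ hT] with L h₁ h₂ hp h₃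
    simp only [tilde_mul q t (fun r => pPow L (α r))] at h₃
    have hsub := h₃.trace_subset fun w => notMem_regularSet hp hq₁
    have hsub₀ : C.trace ⊆ {0}ᶜ := fun z hz => hz₀ z hz
    refine ((continuousOn_const.fun_mul (h₁.1.continuousOn.mono hsub₀)).fun_mul
      (continuousOn_const.fun_mul (h₂.1.continuousOn.mono hsub₀))).fun_mul
      ((differentiableOn_weight hp hq₁ (tilde_ne_zero hq₀ (fun r =>
        mul_ne_zero (ht r) (pPow_ne_zero L (α r))) mf mg)).continuousOn.mono hsub)
  · have hpt : Tendsto (fun L : ℂ => (L, z)) pToZero (pToZero ×ˢ 𝓝 z) :=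
      tendsto_id.prodMk tendsto_const_nhds
    obtain ⟨⟨ℓ, hℓ, hℓ'⟩, hf₂⟩ := hf₁ z fun h => hzN (Or.inl h)
    obtain ⟨⟨ℓ₂, hℓ₂, hℓ₂'⟩, hg₂⟩ := hg₁ z fun h => hzN (Or.inr h)
    -- For the pointwise limit one returns to f, g and the parameters t_r, which produces lc(f),
    -- lc(g) and the weight of the limit form.
    have h₁ := (((tendsto_prod_ellGamma (t := t) hq₁ (hz₀ z hz) hα₀ hα₁ fun r hr => by
      rw [← tilde_mul_pow hq₀ t mf mg r]
      exact ne_zero_of_mem_trace hq₁ hC hz hr _).mul (tendsto_invGammaSq hq₁ (hz₀ z hz))).mul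
      (tendsto_kernel (hz₀ z hz)))
    have h₂ := ((hf₂.mul hg₂).mul h₁).comp hpt
    refine (h₂.congr' ?_).trans (le_of_eq ?_)
    · filter_upwards [hfe, hge, eventually_norm_exp_lt_one,
        (hℓ'.comp hpt).eventually (isOpen_ne.mem_nhds hℓ),
        (hℓ₂'.comp hpt).eventually (isOpen_ne.mem_nhds hℓ₂)] with L h₁ h₂ hp h₃ h₄
      simp only [Function.comp] at h₃ h₄ ⊢
      rw [← h₁.2 z (hz₀ z hz) h₃, ← h₂.2 z (hz₀ z hz) h₄, weight,
        prod_ellGamma_eq hp (Complex.exp_ne_zero L) hq₁ hq₀ (u := fun r => t r * pPow L (α r))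
          (fun r => mul_ne_zero (ht r) (pPow_ne_zero L (α r))) (hz₀ z hz) h₃ h₄]
      ring
    · congr 1
      ring

end EllipticLimit

/-! ### The limit formula, from the prefactor, the integral and the change of contour. -/

open EllipticLimit
theorem mainTheorem7
    (q : ℂ) (hq₀ : q ≠ 0) (hq₁ : ‖q‖ < 1)
    (t : Fin 6 → ℂ) (ht : ∏ r, t r = q)
    (α : Fin 6 → ℝ) (hα₀ : ∀ r, 0 ≤ α r) (hα₁ : ∑ r, α r = 1)
    (mf mg : ℕ)
    -- genericity of the parameters
    (hgen₀ : ∀ r s, α r = 0 → α s = 0 → ∀ j : ℕ,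
      q ^ j * (tilde q mf mg t r * tilde q mf mg t s) ≠ 1)
    (hgen₁ : ∀ r s, r ≠ s → α r + α s = 1 → ∀ j : ℕ, t r * t s ≠ q ^ (j + 1))
    (Sf Sg : HahnSeries ℝ (RatFunc ℂ)) (f g : ℂ → ℂ → ℂ)
    (hf : MemTildeA q (t 4) (α 4) mf Sf f)
    (hg : MemTildeA q (t 5) (α 5) mg Sg g) :
    -- both bilinear forms have contours
    (∃ C : Cycle, IsContour (limitPoints q α (tilde q mf mg t)) C) ∧
    (∀ᶠ L in pToZero, ∃ C : Cycle, IsContour (ellipticPoints (Complex.exp L) q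
      (fun r => tilde q mf mg t r * pPow L (α r))) C) ∧
    -- the limit, for every choice of the contours
    (∀ (C : Cycle) (D : ℂ → Cycle),
      IsContour (limitPoints q α (tilde q mf mg t)) C →
      (∀ᶠ L in pToZero, IsContour (ellipticPoints (Complex.exp L) q
        (fun r => tilde q mf mg t r * pPow L (α r))) (D L)) →
      Tendsto
        (fun L => pPow L (-Sf.order - Sg.order) *
          bilinearForm (Complex.exp L) q (fun r => t r * pPow L (α r)) (D L) (f L) (g L))
        pToZero
        (𝓝 (limitForm q t α C
          (fun z => evalAt z Sf.leadingCoeff) (fun z => evalAt z Sg.leadingCoeff)))) ∧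
    -- the unit circle is a contour of the limit form in the case below
    ((∀ r, α r = 0 → ‖tilde q mf mg t r‖ < 1) →
      IsContour (limitPoints q α (tilde q mf mg t)) unitCircle) := by
  have ht₀ : ∀ r, t r ≠ 0 := fun r =>
    Finset.prod_ne_zero_iff.1 (ht.trans_ne hq₀) r (Finset.mem_univ r)
  have hT := tilde_ne_zero hq₀ ht₀ mf mg
  have hα₂ : ∀ r, α r ≤ 1 := fun r =>
    hα₁ ▸ Finset.single_le_sum (fun s _ => hα₀ s) (Finset.mem_univ r)
  have hα₃ : ∀ r s, r ≠ s → α r + α s ≤ 1 := fun r s hrs => by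
    rw [← hα₁, ← Finset.sum_pair hrs]
    exact Finset.sum_le_sum_of_subset_of_nonneg (Finset.subset_univ _) fun s _ _ => hα₀ s
  obtain ⟨C₀, hC₀⟩ := exists_isContour_limitPoints hq₀ hq₁ hT hgen₀
  refine ⟨⟨C₀, hC₀⟩, (hC₀.eventually_ellipticPoints hq₀ hq₁ hα₀ hT).mono fun L hL => ⟨C₀, hL⟩,
    fun C D hC hD => ?_, fun h => isContour_unitCircle ?_⟩
  · obtain ⟨hf', hfe, hfO⟩ := hf.exists_holomorphic hq₀ (ht₀ 4) (hα₀ 4) (hα₂ 4)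
    obtain ⟨hg', hge, hgO⟩ := hg.exists_holomorphic hq₀ (ht₀ 5) (hα₀ 5) (hα₂ 5)
    have hpre := tendsto_prefactor hq₁ ht₀ hα₀ hα₃ (fun r s _ h => ?_) hgen₁
    · refine (hpre.mul (tendsto_integral_weight hq₀ hq₁ ht₀ hα₀ hα₂ hf hg hfe hge hfO hgO
        hC)).congr' ?_
      filter_upwards [hfe, hge, eventually_norm_exp_lt_one, hD,
        hC.eventually_ellipticPoints hq₀ hq₁ hα₀ hT] with L h₁ h₂ hp h₃ h₄
      simp only [tilde_mul q t (fun r => pPow L (α r))] at h₃ h₄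
      rw [bilinearForm, integral_elliptic_eq hp (Complex.exp_ne_zero L) hq₁ hq₀
        (u := fun r => t r * pPow L (α r)) (fun r => mul_ne_zero (ht₀ r) (pPow_ne_zero L (α r)))
        h₁.1 h₂.1 h₁.2 h₂.2 h₄ h₃, mul_left_comm, sub_eq_add_neg, pPow_add,
        ← Cycle.integral_const_mul C (pPow L (-Sf.order) * pPow L (-Sg.order))]
      congr 2
      funext z
      ring
    · have hr : α r = 0 := by linarith [hα₀ r, hα₀ s]
      have hs : α s = 0 := by linarith [hα₀ r, hα₀ s]
      -- A zero of (t_r t_s;q) is a forbidden relation between t̃_r and t̃_s, with the exponents of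
      -- q in t_r = t̃_r q^m and t_s added to j.
      refine qPoch_ne_zero hq₁ fun j e => hgen₀ r s hr hs
        (![0, 0, 0, 0, mf, mg] r + ![0, 0, 0, 0, mf, mg] s + j) ?_
      rw [← e, ← tilde_mul_pow hq₀ t mf mg r, ← tilde_mul_pow hq₀ t mf mg s]
      ring
  · rintro _ ⟨r, j, hr, rfl⟩
    refine ⟨mul_ne_zero (pow_ne_zero _ hq₀) (hT r), ?_⟩
    rw [norm_mul, norm_pow]
    exact (mul_le_of_le_one_left (norm_nonneg _) (pow_le_one₀ (norm_nonneg _) hq₁.le)).trans_lt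
      (h r hr)
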